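/- Let $S_0$ be a simply connected Riemann surface and let $f:S_0\to S_0$ be a holomorphic branched covering of finite degree $d>1$ (a proper holomorphic map such that every point that is not a critical value has exactly $d$ preimages). The \emph{plaque inverse limit} $S_\infty$ is the set of all sequences $x=(x_1,x_2,\dots)$ in $S_0$ with $f(x_{n+1})=x_n$ for all $n$, with the topology whose basic open sets are the connected components of the open subsets of the standard inverse limit (the same set with the Tychonoff topology). For $U\subset S_\infty$ let $U_n\subset S_0$ be the set of $n$-th coordinates of the points of $U$. A \emph{plaque} is an open set $U\subset S_\infty$ such that $U=\{x : x_n\in U_n \text{ for all } n\}$, each $U_n$ is open and conformally equivalent to the unit disk, and for each $n$ the map $f:U_{n+1}\to U_n$ is conformally conjugate (by conformal maps of $U_{n+1}$ and $U_n$ onto the unit disk) to $w\mapsto w^{t}$ for some $t\ge 1$ depending on $n$. A point $x\in S_\infty$ is \emph{regular} if it lies in a plaque $U$ such that, for all sufficiently large $n$, $U_n$ contains no critical point of $f$; otherwise it is \emph{irregular}. An irregular point is \emph{isolated} if it has an open neighborhood in $S_\infty$ containing no other irregular point. Let $I$ be the Boolean algebra of binary sequences modulo equality at all but finitely many places, ordered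 coordinatewise, and for $a\in I$ let $\alpha(a)=\{b\in I : b\le a\}$. For $U\subset S_\infty$ and a critical point $c$ of $f$ let $\mathrm{ind}(U,c)\in I$ be the class of the sequence whose $n$-th entry is $1$ if and only if $c\in U_n$. The \emph{signature} of $x$ with respect to $c$ is $$\mathrm{sign}(x,c)=\bigcap_{j\ge 1}\alpha(\mathrm{ind}(U(j),c)),$$ where $U(1)\supset U(2)\supset\cdots$ is any sequence of plaques containing $x$ which shrinks to $x$ (every open neighborhood of $x$ contains some $U(j)$); it does not depend on the sequence. It \emph{has a maximal element} if $\mathrm{sign}(x,c)=\alpha(a)$ for some $a\in I$. \textbf{Statement.} Let $x\in S_\infty$ be an isolated irregular point, and suppose that for some critical point $c$ of $f$ the signature $\mathrm{sign}(x,c)$ (formed along some sequence of plaques shrinking to $x$) has no maximal element. Then there is a plaque $U$ containing $x$ such that every open set $V\subset S_\infty$ with $x\in V\subset U$ has uncountably many path-connected components. -/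

import Mathlib

open Set Filter Topology
open scoped Manifold

/-- The standard inverse limit of the iterations of `f`: all backward orbits
`x 0 ← x 1 ← x 2 ← ⋯`. It carries the Tychonoff topology (the subspace topology of the product),
by Mathlib's instances. Level `n` here is the surface called `S_{n+1}` if one counts from `1`. -/
abbrev InverseLimit {S : Type*} (f : S → S) : Type _ :=
  {x : ℕ → S // ∀ n, f (x (n + 1)) = x n}

/-- The plaque inverse limit: the same underlying set as the standard inverse limit. -/
def PlaqueInverseLimit {S : Type*} (f : S → S) : Type _ := InverseLimit f

/-- The topology of the plaque inverse limit: its basic open sets are the connected components of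
the open sets of the standard inverse limit. -/
instance {S : Type*} [TopologicalSpace S] (f : S → S) :
    TopologicalSpace (PlaqueInverseLimit f) :=
  TopologicalSpace.generateFrom
    {C : Set (InverseLimit f) | ∃ O : Set (InverseLimit f), IsOpen O ∧
      ∃ x ∈ O, C = connectedComponentIn O x}

namespace PlaqueInverseLimit

/-- The canonical projection to the `n`-th level. -/
def proj {S : Type*} {f : S → S} (n : ℕ) (x : PlaqueInverseLimit f) : S :=
  (show InverseLimit f from x).1 n

/-- The `n`-th level `U_n` of a subset `U` of the plaque inverse limit. -/
def level {S : Type*} {f : S → S} (U : Set (PlaqueInverseLimit f)) (n : ℕ) : Set S :=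
  proj n '' U

end PlaqueInverseLimit

open PlaqueInverseLimit

/-- Critical points of a holomorphic self-map of a Riemann surface. -/
def IsCriticalPoint {S : Type*} [TopologicalSpace S] [ChartedSpace ℂ S] (f : S → S) (c : S) :
    Prop :=
  mfderiv 𝓘(ℂ) 𝓘(ℂ) f c = 0

/-- `f` is a holomorphic branched covering of finite degree `d` (used for `d ≥ 1`): a proper
holomorphic map for which every point that is not a critical value has exactly `d` preimages. -/
structure IsBranchedCovering {S : Type*} [TopologicalSpace S] [ChartedSpace ℂ S] (f : S → S)
    (d : ℕ) : Prop where
  holomorphic : MDifferentiable 𝓘(ℂ) 𝓘(ℂ) f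
  proper : IsProperMap f
  card_fiber : ∀ y, (∀ c, IsCriticalPoint f c → f c ≠ y) → (f ⁻¹' {y}).ncard = d

/-- `φ` maps the open set `D` conformally onto the open unit disk (values of `φ` outside `D` are
irrelevant). -/
structure IsConformalOntoDisk {S : Type*} [TopologicalSpace S] [ChartedSpace ℂ S] (D : Set S)
    (φ : S → ℂ) : Prop where
  isOpen : IsOpen D
  holomorphic : MDifferentiableOn 𝓘(ℂ) 𝓘(ℂ) φ D
  bijOn : BijOn φ D (Metric.ball 0 1)

/-- Plaques: open sets `U = (U_0, U_1, …)`, i.e. sets consisting of all points `x` with `x_n ∈ U_n`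
for all `n`, such that every level is conformally equivalent to the unit disk and `f` from `U_{n+1}`
to `U_n` is conformally equivalent to the self-map `w ↦ w ^ t` of the unit disk for some `t ≥ 1`
(`t` may depend on `n`; it never exceeds the degree of `f`). -/
structure IsPlaque {S : Type*} [TopologicalSpace S] [ChartedSpace ℂ S] (f : S → S)
    (U : Set (PlaqueInverseLimit f)) : Prop where
  isOpen : IsOpen U
  eq_levels : U = {x | ∀ n, proj n x ∈ level U n}
  conj_pow : ∀ n, ∃ t : ℕ, 1 ≤ t ∧ ∃ φ ψ : S → ℂ,
    IsConformalOntoDisk (level U (n + 1)) φ ∧ IsConformalOntoDisk (level U n) ψ ∧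
      ∀ z ∈ level U (n + 1), ψ (f z) = φ z ^ t

/-- A point is regular if it has a plaque neighborhood whose levels contain no critical points from
some level on. -/
def IsRegularPoint {S : Type*} [TopologicalSpace S] [ChartedSpace ℂ S] (f : S → S)
    (x : PlaqueInverseLimit f) : Prop :=
  ∃ U : Set (PlaqueInverseLimit f), IsPlaque f U ∧ x ∈ U ∧
    ∃ n, ∀ m, n ≤ m → ∀ c ∈ level U m, ¬ IsCriticalPoint f c

/-- An irregular point which has a neighborhood without other irregular points. -/
def IsIsolatedIrregularPoint {S : Type*} [TopologicalSpace S] [ChartedSpace ℂ S] (f : S → S)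
    (x : PlaqueInverseLimit f) : Prop :=
  ¬ IsRegularPoint f x ∧
    ∃ W : Set (PlaqueInverseLimit f), IsOpen W ∧ x ∈ W ∧ ∀ y ∈ W, y ≠ x → IsRegularPoint f y

/-- The Boolean algebra of binary sequences modulo almost equality (equality at all but finitely
many places), with the order `b ≤ a` induced by the coordinatewise order. -/
abbrev BinaryClass : Type := Germ (cofinite : Filter ℕ) Prop

/-- `α(a)`, the set of all classes `b ≤ a`. -/
def alpha (a : BinaryClass) : Set BinaryClass := {b | b ≤ a}

/-- `ind(U, c)`: the class of the sequence whose `n`-th entry is `1` if and only if `c ∈ U_n`. -/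
def index {S : Type*} {f : S → S} (U : Set (PlaqueInverseLimit f)) (c : S) : BinaryClass :=
  ((fun n => c ∈ level U n : ℕ → Prop) : Germ (cofinite : Filter ℕ) Prop)

/-- A sequence of plaque neighborhoods of `x` shrinking to `x`. -/
structure ShrinksTo {S : Type*} [TopologicalSpace S] [ChartedSpace ℂ S] {f : S → S}
    (N : ℕ → Set (PlaqueInverseLimit f)) (x : PlaqueInverseLimit f) : Prop where
  isPlaque : ∀ j, IsPlaque f (N j)
  mem : ∀ j, x ∈ N j
  succ_subset : ∀ j, N (j + 1) ⊆ N j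
  exists_subset : ∀ V : Set (PlaqueInverseLimit f), IsOpen V → x ∈ V → ∃ m, N m ⊆ V

/-- `σ` is the signature `sign(x, c)`: the intersection of all `α(ind(N j, c))` along a sequence `N`
of neighborhoods shrinking to `x`. It does not depend on the sequence, see `IsSignature.unique`. -/
def IsSignature {S : Type*} [TopologicalSpace S] [ChartedSpace ℂ S] {f : S → S}
    (x : PlaqueInverseLimit f) (c : S) (σ : Set BinaryClass) : Prop :=
  ∃ N : ℕ → Set (PlaqueInverseLimit f), ShrinksTo N x ∧ σ = ⋂ j, alpha (index (N j) c)

/-- A signature has a maximal element if it is of the form `α(a)`. -/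
def HasMaximalElement (σ : Set BinaryClass) : Prop := ∃ a, σ = alpha a

theorem index_mono {S : Type*} {f : S → S} {U V : Set (PlaqueInverseLimit f)} (h : U ⊆ V) (c : S) :
    index U c ≤ index V c :=
  Germ.coe_le.2 (Eventually.of_forall fun _ hc => image_mono h hc)

theorem IsSignature.unique {S : Type*} [TopologicalSpace S] [ChartedSpace ℂ S] {f : S → S}
    {x : PlaqueInverseLimit f} {c : S} {σ τ : Set BinaryClass}
    (hσ : IsSignature x c σ) (hτ : IsSignature x c τ) : σ = τ := by
  have key : ∀ N M : ℕ → Set (PlaqueInverseLimit f), ShrinksTo N x → ShrinksTo M x →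
      (⋂ j, alpha (index (N j) c)) ⊆ ⋂ j, alpha (index (M j) c) := by
    intro N M hN hM b hb
    refine mem_iInter.2 fun j => ?_
    obtain ⟨m, hm⟩ := hN.exists_subset (M j) (hM.isPlaque j).isOpen (hM.mem j)
    exact le_trans (mem_iInter.1 hb m) (index_mono hm c)
  obtain ⟨N, hN, rfl⟩ := hσ
  obtain ⟨M, hM, rfl⟩ := hτ
  exact Subset.antisymm (key N M hN hM) (key M N hM hN)

/-!
Let `N 0 ⊇ N 1 ⊇ ⋯` be plaques shrinking to `x`. As the signature has no maximal element, the
indices of the `N j` do not stabilize (`ShrinksTo.exists_infinite`): for every `j` there is a `k`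
such that infinitely many levels of `N j` contain the critical point `c` while the corresponding
levels of `N k` do not. A level of a plaque contains at most one critical point of `f`, so at these
levels the degree of `f` is at least `2` on `N j` and equal to `1` on `N k`
(`IsDegreeSequence.eq_one_and_two_le`). Hence the fiber of `N k` over a point of the bottom level is
infinitely sparser than the fiber of `N j` (`exists_prod_lt_prod`).

Take for `U` a plaque in which `x` is the only irregular point, let `N j ⊆ V ⊆ U`, and let `F` be
the fiber of `N j` over a generic point `p` of its bottom level; it is a Cantor set. The plaque
topology makes `U \ {x}` a surface, covered by sheets: open sets that project homeomorphically onto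
small disks of a level from which on there are no critical points (`IsPlaque.exists_isSheet`). Two
points of a connected subset of `U \ {x}` are joined by a finite chain of sheets over disks from a
countable basis, stepping over points of a countable dense set (`IsPlaque.exists_sheetChain`), so
there are only countably many types of chains. For a given type, the target of the chain determines
its source at every high level (`SheetChain.eventuallyInjective`), because two sheets over the same
disk that meet coincide (`IsSheet.proj_eq_of_proj_eq`). This is a form of monodromy that needs no
lifting of paths.

Suppose that `V` has only countably many path components. A path from a point of `F` to `x` enters
`N k` before it hits `x`, so its initial piece gives a chain from that point to a point of `N k`;
two points of `F` in a path component other than that of `x` are joined by a chain as well. Thus `F`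
is a countable union of sets that consist of the sources of one type of chain with targets in a
fiber of `N k` or in a single point. Such targets are few compared with `F`, so each of these sets
is nowhere dense in `F` (`IsDegreeSequence.isNowhereDenseAbove`), contrary to the Baire category
theorem (`IsNowhereDenseAbove.exists_forall_notMem`).
-/

/-! ### Injective holomorphic functions -/

theorem DifferentiableOn.nhds_le_map_nhds_of_injOn {g : ℂ → ℂ} {O : Set ℂ} (hO : IsOpen O)
    (hg : DifferentiableOn ℂ g O) (hinj : InjOn g O) {z : ℂ} (hz : z ∈ O) :
    𝓝 (g z) ≤ map g (𝓝 z) := by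
  have han : AnalyticAt ℂ g z := hg.analyticAt (hO.mem_nhds hz)
  refine han.eventually_constant_or_nhds_le_map_nhds.resolve_left fun hconst => ?_
  have h1 : ∀ᶠ w in 𝓝[≠] z, g w = g z ∧ w ∈ O :=
    (hconst.and (hO.mem_nhds hz)).filter_mono nhdsWithin_le_nhds
  obtain ⟨w, ⟨hw, hwO⟩, hne⟩ := (h1.and self_mem_nhdsWithin).exists
  exact hne (hinj hwO hz hw)

/-- The local inverse of an injective holomorphic function is continuous, and differentiable away
from the isolated zeros of the derivative; the singularities are removable, so the inverse is
differentiable everywhere and the chain rule excludes a vanishing derivative. -/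
theorem deriv_ne_zero_of_differentiableOn_of_injOn {g : ℂ → ℂ} {O : Set ℂ} (hO : IsOpen O)
    (hg : DifferentiableOn ℂ g O) (hinj : InjOn g O) {z : ℂ} (hz : z ∈ O) : deriv g z ≠ 0 := by
  intro h0
  have hmap : ∀ w ∈ O, 𝓝 (g w) ≤ map g (𝓝 w) := fun w hw =>
    hg.nhds_le_map_nhds_of_injOn hO hinj hw
  let h := Function.invFunOn g O
  have hleft : ∀ w ∈ O, h (g w) = w := fun w hw => hinj.leftInvOn_invFunOn hw
  have hcont : ∀ w ∈ O, ContinuousAt h (g w) := by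
    intro w hw
    have : Tendsto (h ∘ g) (𝓝 w) (𝓝 w) := by
      refine tendsto_id.congr' ?_
      filter_upwards [hO.mem_nhds hw] with v hv using (hleft v hv).symm
    unfold ContinuousAt
    rw [hleft w hw]
    exact (tendsto_map'_iff.2 this).mono_left (hmap w hw)
  have hderiv : ∀ w ∈ O, deriv g w ≠ 0 → DifferentiableAt ℂ h (g w) := by
    intro w hw hne
    have h1 : HasDerivAt g (deriv g w) (h (g w)) := by
      rw [hleft w hw]
      exact (hg.differentiableAt (hO.mem_nhds hw)).hasDerivAt
    refine (h1.of_local_left_inverse (hcont w hw) hne ?_).differentiableAt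
    have : ∀ᶠ y in map g (𝓝 w), g (h y) = y := by
      rw [eventually_map]
      filter_upwards [hO.mem_nhds hw] with v hv
      rw [hleft v hv]
    exact hmap w hw this
  have han : AnalyticAt ℂ (deriv g) z := (hg.analyticAt (hO.mem_nhds hz)).deriv
  have hiso : ∀ᶠ w in 𝓝[≠] z, deriv g w ≠ 0 := by
    refine han.eventually_eq_zero_or_eventually_ne_zero.resolve_left fun hev => ?_
    obtain ⟨r, hr, hball⟩ := Metric.eventually_nhds_iff_ball.1 (hev.and (hO.mem_nhds hz))
    have hconst : ∀ w ∈ Metric.ball z r, g w = g z := fun w hw =>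
      (convex_ball z r).is_const_of_fderivWithin_eq_zero (𝕜 := ℂ)
        (hg.mono fun v hv => (hball v hv).2)
        (fun v hv => by
          rw [fderivWithin_of_isOpen Metric.isOpen_ball hv]
          ext
          simpa using (hball v hv).1) hw (Metric.mem_ball_self hr)
    have h1 : ∀ᶠ w in 𝓝[≠] z, w ∈ Metric.ball z r :=
      (Metric.ball_mem_nhds z hr : _ ∈ 𝓝 z) |> fun h => nhdsWithin_le_nhds h
    obtain ⟨w, hw, hne⟩ := (h1.and self_mem_nhdsWithin).exists
    exact hne (hinj (hball w hw).2 hz (hconst w hw))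
  have hdiff : DifferentiableAt ℂ h (g z) := by
    have hev : ∀ᶠ y in 𝓝 (g z), y ≠ g z → DifferentiableAt ℂ h y := by
      refine hmap z hz ?_
      change ∀ᶠ y in map g (𝓝 z), _
      rw [eventually_map]
      filter_upwards [eventually_nhdsWithin_iff.1 hiso, hO.mem_nhds hz] with w hw hwO hne
      exact hderiv w hwO (hw fun h => hne (by rw [h]))
    refine (Complex.analyticAt_of_differentiable_on_punctured_nhds_of_continuousAt ?_
      (hcont z hz)).differentiableAt
    exact eventually_nhdsWithin_iff.2 hev
  have hc : HasDerivAt (h ∘ g) (deriv h (g z) * deriv g z) z :=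
    hdiff.hasDerivAt.comp z (hg.differentiableAt (hO.mem_nhds hz)).hasDerivAt
  have hid : HasDerivAt (h ∘ g) 1 z := by
    refine (hasDerivAt_id z).congr_of_eventuallyEq ?_
    filter_upwards [hO.mem_nhds hz] with v hv using hleft v hv
  have := hc.unique hid
  simp [h0] at this

/-! ### Conformal maps onto the disk -/

section Conformal

variable {S : Type*} [TopologicalSpace S] [ChartedSpace ℂ S]

namespace IsConformalOntoDisk

variable {D : Set S} {φ : S → ℂ}

theorem mdifferentiableAt (h : IsConformalOntoDisk D φ) {u : S} (hu : u ∈ D) :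
    MDifferentiableAt 𝓘(ℂ) 𝓘(ℂ) φ u :=
  (h.holomorphic u hu).mdifferentiableAt (h.isOpen.mem_nhds hu)

/-- A conformal map read in a chart is an injective holomorphic function on an open set. -/
theorem comp_chart_symm [IsManifold 𝓘(ℂ) 1 S] (h : IsConformalOntoDisk D φ) (u : S) :
    IsOpen ((chartAt ℂ u).target ∩ (chartAt ℂ u).symm ⁻¹' D) ∧
    DifferentiableOn ℂ (φ ∘ (chartAt ℂ u).symm)
      ((chartAt ℂ u).target ∩ (chartAt ℂ u).symm ⁻¹' D) ∧
    InjOn (φ ∘ (chartAt ℂ u).symm) ((chartAt ℂ u).target ∩ (chartAt ℂ u).symm ⁻¹' D) := by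
  refine ⟨(chartAt ℂ u).isOpen_inter_preimage_symm h.isOpen, ?_, ?_⟩
  · intro z hz
    have h1 : MDifferentiableAt 𝓘(ℂ) 𝓘(ℂ) (φ ∘ (chartAt ℂ u).symm) z :=
      (h.mdifferentiableAt hz.2).comp z
        ((mdifferentiable_chart u).mdifferentiableAt_symm hz.1)
    exact (mdifferentiableAt_iff_differentiableAt.1 h1).differentiableWithinAt
  · exact h.bijOn.injOn.comp ((chartAt ℂ u).symm.injOn.mono inter_subset_left)
      fun z hz => hz.2

theorem nhds_le_map_nhds [IsManifold 𝓘(ℂ) 1 S] (h : IsConformalOntoDisk D φ) {u : S}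
    (hu : u ∈ D) : 𝓝 (φ u) ≤ map φ (𝓝 u) := by
  obtain ⟨ho, hd, hi⟩ := h.comp_chart_symm u
  have hmem : chartAt ℂ u u ∈ (chartAt ℂ u).target ∩ (chartAt ℂ u).symm ⁻¹' D :=
    ⟨mem_chart_target ℂ u, by simpa using hu⟩
  have := hd.nhds_le_map_nhds_of_injOn ho hi hmem
  rw [← map_map, (chartAt ℂ u).symm_map_nhds_eq (mem_chart_source ℂ u)] at this
  simpa using this

theorem mfderiv_ne_zero [IsManifold 𝓘(ℂ) 1 S] (h : IsConformalOntoDisk D φ) {u : S}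
    (hu : u ∈ D) : mfderiv 𝓘(ℂ) 𝓘(ℂ) φ u ≠ 0 := by
  intro h0
  obtain ⟨ho, hd, hi⟩ := h.comp_chart_symm u
  have hmem : chartAt ℂ u u ∈ (chartAt ℂ u).target ∩ (chartAt ℂ u).symm ⁻¹' D :=
    ⟨mem_chart_target ℂ u, by simpa using hu⟩
  refine deriv_ne_zero_of_differentiableOn_of_injOn ho hd hi hmem ?_
  have hs : MDifferentiableAt 𝓘(ℂ) 𝓘(ℂ) (chartAt ℂ u).symm (chartAt ℂ u u) :=
    (mdifferentiable_chart u).mdifferentiableAt_symm hmem.1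
  have e : (chartAt ℂ u).symm (chartAt ℂ u u) = u := by simp
  have h1 : HasMFDerivAt 𝓘(ℂ) 𝓘(ℂ) φ u 0 := h0 ▸ (h.mdifferentiableAt hu).hasMFDerivAt
  rw [← e] at h1
  have h2 := h1.comp (chartAt ℂ u u) hs.hasMFDerivAt
  rw [ContinuousLinearMap.zero_comp] at h2
  have h3 : HasFDerivAt (φ ∘ (chartAt ℂ u).symm) (0 : ℂ →L[ℂ] ℂ) (chartAt ℂ u u) :=
    hasMFDerivAt_iff_hasFDerivAt.1 h2
  simpa using h3.hasDerivAt.deriv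

/-- The inverse of a conformal map, as a partial homeomorphism onto the unit disk. -/
theorem exists_openPartialHomeomorph [IsManifold 𝓘(ℂ) 1 S] (h : IsConformalOntoDisk D φ) :
    ∃ e : OpenPartialHomeomorph S ℂ, e.source = D ∧ e.target = Metric.ball 0 1 ∧ ⇑e = φ := by
  by_cases hne : Nonempty S
  · refine ⟨OpenPartialHomeomorph.ofContinuousOpenRestrict
      (h.bijOn.toPartialEquiv φ D (Metric.ball 0 1)) ?_ ?_ ?_, rfl, rfl, rfl⟩
    · exact fun u hu => (h.mdifferentiableAt hu).continuousAt.continuousWithinAt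
    · refine IsOpenMap.of_nhds_le fun u => ?_
      change 𝓝 (φ u) ≤ map (φ ∘ Subtype.val) (𝓝 u)
      have hD : 𝓝[(h.bijOn.toPartialEquiv φ D (Metric.ball 0 1)).source] u.1 = 𝓝 u.1 :=
        h.isOpen.nhdsWithin_eq u.2
      rw [← map_map, map_nhds_subtype_val, hD]
      exact h.nhds_le_map_nhds u.2
    · exact h.isOpen
  · obtain ⟨u, -⟩ := h.bijOn.surjOn (Metric.mem_ball_self one_pos)
    exact (hne ⟨u⟩).elim

end IsConformalOntoDisk

/-- Where `f` is conformally conjugate to `w ↦ w ^ t`, the only possible critical point of `f` is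
the centre, and it is critical exactly when `t ≠ 1`. -/
theorem isCriticalPoint_iff_of_conj_pow [IsManifold 𝓘(ℂ) 1 S] {f : S → S}
    (hf : MDifferentiable 𝓘(ℂ) 𝓘(ℂ) f) {A B : Set S} {φ ψ : S → ℂ}
    (hφ : IsConformalOntoDisk A φ) (hψ : IsConformalOntoDisk B ψ) (hAB : MapsTo f A B)
    {t : ℕ} (ht : 1 ≤ t) (hconj : ∀ z ∈ A, ψ (f z) = φ z ^ t) {u : S} (hu : u ∈ A) :
    IsCriticalPoint f u ↔ t ≠ 1 ∧ φ u = 0 := by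
  have h1 : HasMFDerivAt 𝓘(ℂ) 𝓘(ℂ) (ψ ∘ f) u
      ((mfderiv 𝓘(ℂ) 𝓘(ℂ) ψ (f u)).comp (mfderiv 𝓘(ℂ) 𝓘(ℂ) f u)) :=
    (hψ.mdifferentiableAt (hAB hu)).hasMFDerivAt.comp u (hf u).hasMFDerivAt
  have hp : HasMFDerivAt 𝓘(ℂ) 𝓘(ℂ) (fun w : ℂ => w ^ t) (φ u)
      (ContinuousLinearMap.toSpanSingleton ℂ ((t : ℂ) * φ u ^ (t - 1))) :=
    hasMFDerivAt_iff_hasFDerivAt.2 (hasDerivAt_pow t (φ u)).hasFDerivAt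
  have h2 := hp.comp u (hφ.mdifferentiableAt hu).hasMFDerivAt
  have h3 := h2.congr_of_eventuallyEq (f₁ := ψ ∘ f) (by
    filter_upwards [hφ.isOpen.mem_nhds hu] with v hv using hconj v hv)
  have key := hasMFDerivAt_unique h1 h3
  obtain ⟨Lψ, hLψ⟩ : ∃ L : ℂ →L[ℂ] ℂ, L = mfderiv 𝓘(ℂ) 𝓘(ℂ) ψ (f u) := ⟨_, rfl⟩
  obtain ⟨Lφ, hLφ⟩ : ∃ L : ℂ →L[ℂ] ℂ, L = mfderiv 𝓘(ℂ) 𝓘(ℂ) φ u := ⟨_, rfl⟩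
  obtain ⟨Lf, hLf⟩ : ∃ L : ℂ →L[ℂ] ℂ, L = mfderiv 𝓘(ℂ) 𝓘(ℂ) f u := ⟨_, rfl⟩
  have hkey : ∀ v : ℂ, Lψ (Lf v) = Lφ v * ((t : ℂ) * φ u ^ (t - 1)) := by
    intro v
    rw [hLψ, hLφ, hLf]
    exact DFunLike.congr_fun key v
  have one : ∀ L : ℂ →L[ℂ] ℂ, L ≠ 0 → ∀ v, L v = 0 → v = 0 := by
    intro L hL v hv
    by_contra hne
    refine hL (ContinuousLinearMap.ext fun w => ?_)
    have : w = (w / v) • v := by field_simp [hne]; simp [hne]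
    rw [this, map_smul, hv, smul_zero]
    rfl
  have hφ0 : Lφ ≠ 0 := hLφ ▸ hφ.mfderiv_ne_zero hu
  have hψ0 : Lψ ≠ 0 := hLψ ▸ hψ.mfderiv_ne_zero (hAB hu)
  have ht0 : (t : ℂ) ≠ 0 := by exact_mod_cast (by omega : t ≠ 0)
  constructor
  · intro hc
    have h5 := hkey 1
    rw [show Lf = 0 from hLf.trans hc] at h5
    simp only [zero_apply, map_zero] at h5
    have h6 : φ u ^ (t - 1) = 0 := by
      rcases mul_eq_zero.1 h5.symm with h | h
      · exact absurd (one _ hφ0 1 h) one_ne_zero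
      · exact (mul_eq_zero.1 h).resolve_left ht0
    refine ⟨?_, eq_zero_of_pow_eq_zero h6⟩
    rintro rfl
    simp at h6
  · rintro ⟨ht1, h0⟩
    have ht2 : t - 1 ≠ 0 := by omega
    refine hLf.symm.trans (ContinuousLinearMap.ext fun v => ?_)
    refine one _ hψ0 _ ?_
    exact (hkey v).trans (by simp [h0, ht2])

/-- A map conjugate to `w ↦ w ^ t` by conformal maps is open. -/
theorem nhds_le_map_nhds_of_conj_pow [IsManifold 𝓘(ℂ) 1 S] {f : S → S}
    {A B : Set S} {φ ψ : S → ℂ}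
    (hφ : IsConformalOntoDisk A φ) (hψ : IsConformalOntoDisk B ψ) (hAB : MapsTo f A B)
    {t : ℕ} (ht : 1 ≤ t) (hconj : ∀ z ∈ A, ψ (f z) = φ z ^ t) {u : S} (hu : u ∈ A) :
    𝓝 (f u) ≤ map f (𝓝 u) := by
  obtain ⟨e, hes, het, rfl⟩ := hψ.exists_openPartialHomeomorph
  have hfu : f u ∈ e.source := hes ▸ hAB hu
  have : NeZero t := ⟨by omega⟩
  have h1 : 𝓝 (e (f u)) ≤ map (e ∘ f) (𝓝 u) := by
    calc 𝓝 (e (f u)) = 𝓝 (φ u ^ t) := by rw [hconj u hu]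
      _ ≤ map (· ^ t) (𝓝 (φ u)) := (Complex.isOpenQuotientMap_pow t).isOpenMap.nhds_le (φ u)
      _ ≤ map (· ^ t) (map φ (𝓝 u)) := map_mono (hφ.nhds_le_map_nhds hu)
      _ = map (e ∘ f) (𝓝 u) := by
        rw [map_map]
        refine map_congr ?_
        filter_upwards [hφ.isOpen.mem_nhds hu] with v hv using (hconj v hv).symm
  have h2 := map_mono (m := e.symm) h1
  rw [e.symm_map_nhds_eq hfu, map_map] at h2
  refine h2.trans (le_of_eq (Filter.map_congr ?_))
  filter_upwards [hφ.isOpen.mem_nhds hu] with v hv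
  exact e.left_inv (hes ▸ hAB hv)

end Conformal

/-! ### The topology of the plaque inverse limit -/

namespace PlaqueInverseLimit

section Basic

variable {S : Type*} {f : S → S}

/-- The identity, from the plaque topology to the Tychonoff topology. -/
def toInverseLimit (w : PlaqueInverseLimit f) : InverseLimit f := w

theorem apply_proj_succ (w : PlaqueInverseLimit f) (n : ℕ) : f (proj (n + 1) w) = proj n w :=
  w.2 n

theorem iterate_proj (w : PlaqueInverseLimit f) {m n : ℕ} (h : m ≤ n) :
    f^[n - m] (proj n w) = proj m w := by
  induction n, h using Nat.le_induction with
  | base => simp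
  | succ n h ih =>
    rw [Nat.succ_sub h, Function.iterate_succ_apply, apply_proj_succ w, ih]

theorem ext_proj {w w' : PlaqueInverseLimit f} (h : ∀ n, proj n w = proj n w') : w = w' :=
  Subtype.ext (funext h)

theorem proj_mem_level {U : Set (PlaqueInverseLimit f)} {w : PlaqueInverseLimit f} (hw : w ∈ U)
    (n : ℕ) : proj n w ∈ level U n :=
  mem_image_of_mem _ hw

theorem mapsTo_level (U : Set (PlaqueInverseLimit f)) (n : ℕ) :
    MapsTo f (level U (n + 1)) (level U n) := by
  rintro _ ⟨w, hw, rfl⟩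
  exact ⟨w, hw, (apply_proj_succ w n).symm⟩

theorem mapsTo_iterate_level (U : Set (PlaqueInverseLimit f)) {m n : ℕ} (h : m ≤ n) :
    MapsTo f^[n - m] (level U n) (level U m) := by
  rintro _ ⟨w, hw, rfl⟩
  exact ⟨w, hw, (iterate_proj w h).symm⟩

theorem injOn_iterate_level {U : Set (PlaqueInverseLimit f)} {n₀ : ℕ}
    (h : ∀ n, n₀ ≤ n → InjOn f (level U (n + 1))) {m n : ℕ}
    (hm : n₀ ≤ m) (hmn : m ≤ n) : InjOn f^[n - m] (level U n) := by
  induction n, hmn using Nat.le_induction with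
  | base => simp [injOn_id]
  | succ n hn ih =>
    rw [Nat.succ_sub hn, Function.iterate_succ]
    exact ih.comp (h n (hm.trans hn)) (mapsTo_level U n)

variable [TopologicalSpace S]

theorem continuous_toInverseLimit : Continuous (toInverseLimit : PlaqueInverseLimit f → _) := by
  refine continuous_def.2 fun O hO => isOpen_iff_forall_mem_open.2 fun y hy => ?_
  exact ⟨toInverseLimit ⁻¹' connectedComponentIn O (toInverseLimit y),
    preimage_mono (connectedComponentIn_subset _ _),
    TopologicalSpace.isOpen_generateFrom_of_mem ⟨O, hO, toInverseLimit y, hy, rfl⟩,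
    (mem_connectedComponentIn (F := O) (x := toInverseLimit y) hy :)⟩

theorem continuous_proj (n : ℕ) : Continuous (proj n : PlaqueInverseLimit f → S) :=
  ((continuous_apply n).comp continuous_subtype_val).comp continuous_toInverseLimit

/-- Connected components of Tychonoff open sets form a basis, and not only a subbasis, of the plaque
topology. -/
theorem exists_connectedComponentIn_subset {U : Set (PlaqueInverseLimit f)} (hU : IsOpen U)
    {y : PlaqueInverseLimit f} (hy : y ∈ U) :
    ∃ O : Set (InverseLimit f), IsOpen O ∧ toInverseLimit y ∈ O ∧
      toInverseLimit ⁻¹' connectedComponentIn O (toInverseLimit y) ⊆ U := by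
  induction hU with
  | basic C hC =>
    obtain ⟨O, hO, z, hz, rfl⟩ := hC
    refine ⟨O, hO, connectedComponentIn_subset _ _ hy, ?_⟩
    exact (congrArg (toInverseLimit ⁻¹' ·) (connectedComponentIn_eq hy)).ge
  | univ => exact ⟨univ, isOpen_univ, mem_univ _, subset_univ _⟩
  | inter s t _ _ ihs iht =>
    obtain ⟨O, hO, hyO, h⟩ := ihs hy.1
    obtain ⟨O', hO', hyO', h'⟩ := iht hy.2
    exact ⟨O ∩ O', hO.inter hO', ⟨hyO, hyO'⟩, subset_inter
      ((preimage_mono (connectedComponentIn_mono _ inter_subset_left)).trans h)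
      ((preimage_mono (connectedComponentIn_mono _ inter_subset_right)).trans h')⟩
  | sUnion s _ ih =>
    obtain ⟨t, ht, hyt⟩ := hy
    obtain ⟨O, hO, hyO, h⟩ := ih t ht hyt
    exact ⟨O, hO, hyO, h.trans (subset_sUnion_of_mem ht)⟩

/-- Since the lower coordinates of a backward orbit are continuous functions of a higher one, a
single coordinate suffices to describe neighborhoods in the Tychonoff topology. -/
theorem exists_preimage_proj_subset (hf : Continuous f) {O : Set (InverseLimit f)} (hO : IsOpen O)
    {y : PlaqueInverseLimit f} (hy : toInverseLimit y ∈ O) :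
    ∃ n, ∀ M, n ≤ M → ∃ O' : Set S, IsOpen O' ∧ proj M y ∈ O' ∧
      ∀ w : PlaqueInverseLimit f, proj M w ∈ O' → toInverseLimit w ∈ O := by
  obtain ⟨O₁, hO₁, rfl⟩ := isOpen_induced_iff.1 hO
  obtain ⟨I, u, hu, hsub⟩ := isOpen_pi_iff.1 hO₁ _ hy
  have hle : ∀ {M}, I.sup id ≤ M → ∀ i ∈ I, i ≤ M := fun hM i hi =>
    (Finset.le_sup (f := id) hi).trans hM
  refine ⟨I.sup id, fun M hM => ⟨⋂ i ∈ I, f^[M - i] ⁻¹' u i, ?_, ?_, ?_⟩⟩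
  · exact I.finite_toSet.isOpen_biInter fun i hi => (hu i hi).1.preimage (hf.iterate _)
  · refine mem_iInter₂.2 fun i hi => ?_
    rw [mem_preimage, iterate_proj y (hle hM i hi)]
    exact (hu i hi).2
  · intro w hw
    refine hsub fun i hi => ?_
    have h1 := mem_iInter₂.1 hw i hi
    rw [mem_preimage, iterate_proj w (hle hM i hi)] at h1
    exact h1

end Basic

instance {S : Type*} [TopologicalSpace S] [T2Space S] (f : S → S) :
    T2Space (PlaqueInverseLimit f) :=
  T2Space.of_injective_continuous (f := fun w n => proj n w)
    (fun _ _ h => ext_proj (congrFun h)) (continuous_pi continuous_proj)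

end PlaqueInverseLimit

/-! ### Plaques -/

section Plaque

variable {S : Type*} [TopologicalSpace S] [ChartedSpace ℂ S] {f : S → S}
  {U : Set (PlaqueInverseLimit f)}

namespace IsPlaque

theorem isOpen_level (hU : IsPlaque f U) (n : ℕ) : IsOpen (level U n) := by
  obtain ⟨t, -, φ, ψ, -, hψ, -⟩ := hU.conj_pow n
  exact hψ.isOpen

variable [IsManifold 𝓘(ℂ) 1 S]

theorem nhds_le_map_nhds (hU : IsPlaque f U) {n : ℕ} {u : S}
    (hu : u ∈ level U (n + 1)) : 𝓝 (f u) ≤ map f (𝓝 u) := by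
  obtain ⟨t, ht, φ, ψ, hφ, hψ, h⟩ := hU.conj_pow n
  exact nhds_le_map_nhds_of_conj_pow hφ hψ (mapsTo_level U n) ht h hu

theorem nhds_le_map_iterate_nhds (hU : IsPlaque f U) {m n : ℕ} (hmn : m ≤ n) {u : S}
    (hu : u ∈ level U n) : 𝓝 (f^[n - m] u) ≤ map f^[n - m] (𝓝 u) := by
  induction n, hmn using Nat.le_induction generalizing u with
  | base => simp
  | succ n h ih =>
    rw [Nat.succ_sub h, Function.iterate_succ, ← map_map]
    exact (ih (mapsTo_level U n hu)).trans (map_mono (hU.nhds_le_map_nhds hu))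

theorem isOpen_image_iterate (hU : IsPlaque f U) {m n : ℕ} (hmn : m ≤ n) {O : Set S}
    (hO : IsOpen O) (hOU : O ⊆ level U n) : IsOpen (f^[n - m] '' O) := by
  refine isOpen_iff_mem_nhds.2 ?_
  rintro _ ⟨u, hu, rfl⟩
  exact hU.nhds_le_map_iterate_nhds hmn (hOU hu) (image_mem_map (hO.mem_nhds hu))

/-- On a level without critical points the exponent is `1`, so `f` is injective there. -/
theorem injOn_of_not_isCriticalPoint (hf : MDifferentiable 𝓘(ℂ) 𝓘(ℂ) f) (hU : IsPlaque f U)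
    {n : ℕ} (h : ∀ c ∈ level U (n + 1), ¬ IsCriticalPoint f c) : InjOn f (level U (n + 1)) := by
  obtain ⟨t, ht, φ, ψ, hφ, hψ, hc⟩ := hU.conj_pow n
  obtain ⟨u, hu, hu0⟩ := hφ.bijOn.surjOn (Metric.mem_ball_self one_pos)
  have h1 := h u hu
  rw [isCriticalPoint_iff_of_conj_pow hf hφ hψ (mapsTo_level U n) ht hc hu] at h1
  have ht1 : t = 1 := by tauto
  intro a ha b hb hab
  apply hφ.bijOn.injOn ha hb
  have := hc a ha
  rw [hab, hc b hb, ht1, pow_one, pow_one] at this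
  exact this.symm

/-- The levels of a plaque are second countable, being disks: a countable basis consists of the
preimages of small balls around the points of a dense sequence. It does not depend on the second
countability of the whole surface. -/
theorem exists_countable_basis (hU : IsPlaque f U) (n : ℕ) :
    ∃ 𝓑 : Set (Set S), 𝓑.Countable ∧ (∀ D ∈ 𝓑, IsPreconnected D) ∧
      ∀ O, IsOpen O → ∀ u ∈ O, u ∈ level U n → ∃ D ∈ 𝓑, IsOpen D ∧ u ∈ D ∧ D ⊆ O := by
  obtain ⟨t, -, φ, ψ, -, hψ, -⟩ := hU.conj_pow n
  obtain ⟨e, hes, het, rfl⟩ := hψ.exists_openPartialHomeomorph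
  let B : ℕ × ℕ → Set ℂ := fun i =>
    Metric.ball 0 1 ∩ Metric.ball (TopologicalSpace.denseSeq ℂ i.1) (1 / ((i.2 : ℝ) + 1))
  have hB : ∀ i, IsOpen (B i) := fun i => Metric.isOpen_ball.inter Metric.isOpen_ball
  refine ⟨range fun i => e.symm '' B i, countable_range _, ?_, ?_⟩
  · rintro _ ⟨i, rfl⟩
    refine (((convex_ball _ _).inter (convex_ball _ _)).isPreconnected).image _
      (e.continuousOn_symm.mono ?_)
    rw [het]
    exact inter_subset_left
  · intro O hO u huO hu
    have hu' : u ∈ e.source := hes ▸ hu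
    have hOopen : IsOpen (e.target ∩ e.symm ⁻¹' O) := e.isOpen_inter_preimage_symm hO
    obtain ⟨r, hr, hball⟩ := Metric.isOpen_iff.1 hOopen (e u)
      ⟨e.map_source hu', by rw [mem_preimage, e.left_inv hu']; exact huO⟩
    obtain ⟨k, hk⟩ := exists_nat_one_div_lt (half_pos hr)
    have hk0 : (0 : ℝ) < 1 / ((k : ℝ) + 1) := by positivity
    obtain ⟨i, hi⟩ := (TopologicalSpace.denseRange_denseSeq ℂ).exists_dist_lt (e u) hk0
    have hmem : e u ∈ B (i, k) := ⟨het ▸ e.map_source hu', hi⟩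
    have hsub : B (i, k) ⊆ e.target ∩ e.symm ⁻¹' O := by
      intro w hw
      apply hball
      have h1 : dist w (TopologicalSpace.denseSeq ℂ i) < 1 / ((k : ℝ) + 1) := hw.2
      rw [Metric.mem_ball]
      linarith [dist_triangle_right w (e u) (TopologicalSpace.denseSeq ℂ i)]
    refine ⟨_, ⟨(i, k), rfl⟩, e.isOpen_image_symm_of_subset_target (hB _)
      (hsub.trans inter_subset_left), ⟨e u, hmem, e.left_inv hu'⟩, ?_⟩
    rintro _ ⟨w, hw, rfl⟩
    exact (hsub hw).2

theorem exists_countable_dense (hU : IsPlaque f U) (n : ℕ) :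
    ∃ T : Set S, T.Countable ∧ ∀ O, IsOpen O → O.Nonempty → O ⊆ level U n → (O ∩ T).Nonempty := by
  obtain ⟨𝓑, h𝓑, -, hb⟩ := hU.exists_countable_basis n
  have : Nonempty S := let ⟨_, _, φ, _, hφ, _, _⟩ := hU.conj_pow n
    let ⟨u, _, _⟩ := hφ.bijOn.surjOn (Metric.mem_ball_self one_pos); ⟨u⟩
  choose! g hg using fun (D : Set S) (hD : D.Nonempty) => hD
  refine ⟨g '' 𝓑, h𝓑.image g, fun O hO ⟨u, hu⟩ hOU => ?_⟩
  obtain ⟨D, hD, -, huD, hDO⟩ := hb O hO u hu (hOU hu)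
  exact ⟨g D, hDO (hg D ⟨u, huD⟩), mem_image_of_mem g hD⟩

end IsPlaque

end Plaque

/-! ### Sheets -/

section Sheet

variable {S : Type*} [TopologicalSpace S] {f : S → S}

/-- A sheet of `U` over the preconnected set `D` at level `M`: an open subset of `U` that projects
bijectively onto `D`, and whose levels above `M` are open. -/
structure IsSheet (U : Set (PlaqueInverseLimit f)) (M : ℕ) (D : Set S)
    (P : Set (PlaqueInverseLimit f)) : Prop where
  isOpen : IsOpen P
  subset : P ⊆ U
  isOpen_level : ∀ n, M ≤ n → IsOpen (level P n)
  level_eq : level P M = D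
  isPreconnected : IsPreconnected D
  injOn : InjOn (proj M) P

variable [ChartedSpace ℂ S] [IsManifold 𝓘(ℂ) 1 S] {U : Set (PlaqueInverseLimit f)}

/-- Regular points of a plaque have arbitrarily small sheet neighborhoods. Far enough out, `f` is
injective on the levels of a plaque `Q` without critical points, so the points of `Q` over a small
connected set `D` form a connected set; as such it lies in a given basic neighborhood as soon as it
lies in the open set of which that neighborhood is a component. -/
theorem IsPlaque.exists_isSheet (hf : MDifferentiable 𝓘(ℂ) 𝓘(ℂ) f) (hU : IsPlaque f U)
    {𝓑 : ℕ → Set (Set S)} (hconn : ∀ n, ∀ D ∈ 𝓑 n, IsPreconnected D)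
    (h𝓑 : ∀ n, ∀ O, IsOpen O → ∀ u ∈ O, u ∈ level U n → ∃ D ∈ 𝓑 n, IsOpen D ∧ u ∈ D ∧ D ⊆ O)
    {y : PlaqueInverseLimit f} (hreg : IsRegularPoint f y) (hyU : y ∈ U)
    {O : Set (PlaqueInverseLimit f)} (hO : IsOpen O) (hy : y ∈ O) :
    ∃ M, ∃ D ∈ 𝓑 M, ∃ P, IsSheet U M D P ∧ y ∈ P ∧ P ⊆ O := by
  obtain ⟨Q, hQ, hyQ, n₀, hn₀⟩ := hreg
  have hinj : ∀ n, n₀ ≤ n → InjOn f (level Q (n + 1)) := fun n hn =>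
    hQ.injOn_of_not_isCriticalPoint hf (hn₀ (n + 1) (by omega))
  obtain ⟨O₁, hO₁, hyO₁, hsub⟩ :=
    exists_connectedComponentIn_subset (hO.inter hU.isOpen) ⟨hy, hyU⟩
  obtain ⟨n₁, hn₁⟩ := exists_preimage_proj_subset hf.continuous hO₁ hyO₁
  obtain ⟨O₂, hO₂, hyO₂, hO₂sub⟩ := hn₁ (max n₀ n₁) (le_max_right _ _)
  generalize hM : max n₀ n₁ = M at *
  have hM₀ : n₀ ≤ M := hM ▸ le_max_left _ _
  obtain ⟨D, hD, hDo, hyD, hDsub⟩ := h𝓑 M (O₂ ∩ level Q M) (hO₂.inter (hQ.isOpen_level M))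
    (proj M y) ⟨hyO₂, proj_mem_level hyQ M⟩ (proj_mem_level hyU M)
  have hinjQ : ∀ {w w'}, w ∈ Q → w' ∈ Q → ∀ {m}, M ≤ m → proj M w = proj M w' →
      proj m w = proj m w' := by
    intro w w' hw hw' m hm h
    refine injOn_iterate_level hinj hM₀ hm (proj_mem_level hw m) (proj_mem_level hw' m) ?_
    rwa [iterate_proj w hm, iterate_proj w' hm]
  have hinjQ' : InjOn (proj M) Q := by
    intro w hw w' hw' h
    refine ext_proj fun m => ?_
    rcases le_total M m with hm | hm
    · exact hinjQ hw hw' hm h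
    · rw [← iterate_proj w hm, ← iterate_proj w' hm, h]
  let P : Set (PlaqueInverseLimit f) := Q ∩ proj M ⁻¹' D
  have hsurj : ∀ p : D, ∃ w ∈ Q, proj M w = p := fun p => (hDsub p.2).2
  choose g hgQ hgM using hsurj
  -- The section of `proj M` over `D` is continuous for the Tychonoff topology.
  have hg : Continuous fun p => toInverseLimit (g p) := by
    refine continuous_induced_rng.2 (continuous_pi fun m => ?_)
    change Continuous fun p => proj m (g p)
    rcases le_total M m with hm | hm
    · refine continuous_def.2 fun G hG => ?_
      have h1 : IsOpen (f^[m - M] '' (G ∩ level Q m)) :=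
        hQ.isOpen_image_iterate hm (hG.inter (hQ.isOpen_level m)) inter_subset_right
      convert h1.preimage continuous_subtype_val using 1
      ext p
      constructor
      · intro hp
        exact ⟨proj m (g p), ⟨hp, proj_mem_level (hgQ p) m⟩, by rw [iterate_proj _ hm, hgM]⟩
      · rintro ⟨_, ⟨hv, w, hw, rfl⟩, h⟩
        rw [iterate_proj _ hm, ← hgM] at h
        change proj m (g p) ∈ G
        rwa [← hinjQ hw (hgQ p) hm h]
    · have h1 : (fun p : D => proj m (g p)) = fun p : D => f^[M - m] p := by
        funext p
        rw [← iterate_proj (g p) hm, hgM]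
      rw [h1]
      exact (hf.continuous.iterate _).comp continuous_subtype_val
  have hP : ∀ w ∈ P, ∃ p, g p = w := fun w hw =>
    ⟨⟨proj M w, hw.2⟩, hinjQ' (hgQ _) hw.1 (hgM _)⟩
  have hyP : y ∈ P := ⟨hyQ, hyD⟩
  have hPO : P ⊆ O ∩ U := by
    have hpre : IsPreconnected (range fun p => toInverseLimit (g p)) := by
      have : PreconnectedSpace D := Subtype.preconnectedSpace (hconn M D hD)
      exact isPreconnected_range hg
    have h1 : (range fun p => toInverseLimit (g p)) ⊆
        connectedComponentIn O₁ (toInverseLimit y) := by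
      refine hpre.subset_connectedComponentIn ?_ ?_
      · obtain ⟨p, hp⟩ := hP y hyP
        exact ⟨p, congrArg toInverseLimit hp⟩
      · rintro _ ⟨p, rfl⟩
        exact hO₂sub _ (by rw [hgM]; exact (hDsub p.2).1)
    intro w hw
    obtain ⟨p, rfl⟩ := hP w hw
    exact hsub (h1 ⟨p, rfl⟩)
  refine ⟨M, D, hD, P, ⟨hQ.isOpen.inter (hDo.preimage (continuous_proj M)),
    hPO.trans inter_subset_right, fun m hm => ?_, ?_, hconn M D hD, hinjQ'.mono inter_subset_left⟩,
    hyP, hPO.trans inter_subset_left⟩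
  · have : level P m = level Q m ∩ f^[m - M] ⁻¹' D := by
      ext u
      constructor
      · rintro ⟨w, hw, rfl⟩
        exact ⟨proj_mem_level hw.1 m, by rw [mem_preimage, iterate_proj w hm]; exact hw.2⟩
      · rintro ⟨⟨w, hw, rfl⟩, h⟩
        rw [mem_preimage, iterate_proj w hm] at h
        exact ⟨w, ⟨hw, h⟩, rfl⟩
    rw [this]
    exact (hQ.isOpen_level m).inter (hDo.preimage (hf.continuous.iterate _))
  · refine Subset.antisymm ?_ fun p hp => ?_
    · rintro _ ⟨w, hw, rfl⟩
      exact hw.2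
    · exact ⟨g ⟨p, hp⟩, ⟨hgQ _, by rw [mem_preimage, hgM]; exact hp⟩, hgM _⟩

/-- Two sheets over the same connected set `D` that meet at level `n` agree at level `n`: the set
of points of `D` over which they agree is open and closed in `D`. -/
theorem IsSheet.proj_eq_of_proj_eq [T2Space S] (hU : IsPlaque f U) {M : ℕ} {D : Set S}
    {P P' : Set (PlaqueInverseLimit f)} (hP : IsSheet U M D P) (hP' : IsSheet U M D P')
    {y y' z z' : PlaqueInverseLimit f} (hy : y ∈ P) (hy' : y' ∈ P') (hz : z ∈ P) (hz' : z' ∈ P')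
    {n : ℕ} (hn : M ≤ n) (hzz : proj n z = proj n z') (hyy : proj M y = proj M y') :
    proj n y = proj n y' := by
  have hlev : ∀ {m}, level P m ⊆ level U m := fun {m} => image_mono hP.subset
  have hlev' : ∀ {m}, level P' m ⊆ level U m := fun {m} => image_mono hP'.subset
  let E := f^[n - M] '' (level P n ∩ level P' n)
  have hE : IsOpen E := hU.isOpen_image_iterate hn
    ((hP.isOpen_level n hn).inter (hP'.isOpen_level n hn)) (inter_subset_left.trans hlev)
  let G := {p | ∃ w ∈ P, ∃ w' ∈ P', proj M w = p ∧ proj M w' = p ∧ proj n w ≠ proj n w'}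
  have hG : IsOpen G := by
    refine isOpen_iff_forall_mem_open.2 ?_
    rintro p ⟨w, hw, w', hw', hwp, hwp', hne⟩
    obtain ⟨O, O', hO, hO', hwO, hwO', hdisj⟩ := t2_separation hne
    refine ⟨f^[n - M] '' (O ∩ level P n) ∩ f^[n - M] '' (O' ∩ level P' n), ?_, ?_, ?_⟩
    · rintro _ ⟨⟨_, ⟨hv, v, hvP, rfl⟩, rfl⟩, _, ⟨hv', v', hvP', rfl⟩, h⟩
      rw [iterate_proj v hn]
      rw [iterate_proj v hn, iterate_proj v' hn] at h
      exact ⟨v, hvP, v', hvP', rfl, h, hdisj.ne_of_mem hv hv'⟩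
    · exact (hU.isOpen_image_iterate hn (hO.inter (hP.isOpen_level n hn))
        (inter_subset_right.trans hlev)).inter
        (hU.isOpen_image_iterate hn (hO'.inter (hP'.isOpen_level n hn))
        (inter_subset_right.trans hlev'))
    · exact ⟨⟨proj n w, ⟨hwO, proj_mem_level hw n⟩, by rw [iterate_proj w hn, hwp]⟩,
        ⟨proj n w', ⟨hwO', proj_mem_level hw' n⟩, by rw [iterate_proj w' hn, hwp']⟩⟩
  have hcover : D ⊆ E ∪ G := by
    intro p hp
    obtain ⟨w, hw, hwp⟩ := hP.level_eq.symm ▸ hp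
    obtain ⟨w', hw', hwp'⟩ := hP'.level_eq.symm ▸ hp
    by_cases h : proj n w = proj n w'
    · exact Or.inl ⟨proj n w, ⟨proj_mem_level hw n, h ▸ proj_mem_level hw' n⟩,
        by rw [iterate_proj w hn, hwp]⟩
    · exact Or.inr ⟨w, hw, w', hw', hwp, hwp', h⟩
  by_contra hne
  obtain ⟨p, -, hpE, hpG⟩ := hP.isPreconnected E G hE hG hcover
    ⟨proj M z, hP.level_eq ▸ proj_mem_level hz M, proj n z,
      ⟨proj_mem_level hz n, hzz ▸ proj_mem_level hz' n⟩, iterate_proj z hn⟩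
    ⟨proj M y, hP.level_eq ▸ proj_mem_level hy M, y, hy, y', hy', rfl, hyy.symm, hne⟩
  obtain ⟨_, ⟨⟨v, hv, rfl⟩, v', hv', hvv⟩, rfl⟩ := hpE
  obtain ⟨w, hw, w', hw', h, h', hww⟩ := hpG
  rw [iterate_proj v hn] at h h'
  rw [hP.injOn hw hv h] at hww
  have hv'' : proj M v' = proj M v := by rw [← iterate_proj v' hn, hvv, iterate_proj v hn]
  rw [hP'.injOn hw' hv' (h'.trans hv''.symm)] at hww
  exact hww hvv.symm

end Sheet

/-! ### Chains of sheets -/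

section Chain

variable {S : Type*} [TopologicalSpace S] {f : S → S}

/-- One step inside a sheet over `D` at level `M` that starts above the point `p`, where the index
is `(M, D, p)`. -/
def SheetStep (U : Set (PlaqueInverseLimit f)) (i : ℕ × Set S × S)
    (y z : PlaqueInverseLimit f) : Prop :=
  ∃ P, IsSheet U i.1 i.2.1 P ∧ y ∈ P ∧ z ∈ P ∧ proj i.1 y = i.2.2

/-- A finite sequence of steps inside sheets; the head of the list belongs to the last step. -/
def SheetChain (U : Set (PlaqueInverseLimit f)) :
    List (ℕ × Set S × S) → PlaqueInverseLimit f → PlaqueInverseLimit f → Prop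
  | [], y, z => y = z
  | i :: l, y, z => ∃ w, SheetChain U l y w ∧ SheetStep U i w z

/-- The relation `R` is injective at every sufficiently high level: the coordinate of the target
determines that of the source. -/
def EventuallyInjective (R : PlaqueInverseLimit f → PlaqueInverseLimit f → Prop) : Prop :=
  ∃ M, ∀ n, M ≤ n → ∀ y z y' z', R y z → R y' z' → proj n z = proj n z' → proj n y = proj n y'

variable [ChartedSpace ℂ S] [IsManifold 𝓘(ℂ) 1 S] {U : Set (PlaqueInverseLimit f)}

theorem SheetStep.eventuallyInjective [T2Space S] (hU : IsPlaque f U) (i : ℕ × Set S × S) :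
    EventuallyInjective (SheetStep U i) := by
  refine ⟨i.1, ?_⟩
  rintro n hn y z y' z' ⟨P, hP, hy, hz, hyp⟩ ⟨P', hP', hy', hz', hyp'⟩ h
  exact hP.proj_eq_of_proj_eq hU hP' hy hy' hz hz' hn h (hyp.trans hyp'.symm)

theorem SheetChain.eventuallyInjective [T2Space S] (hU : IsPlaque f U)
    (l : List (ℕ × Set S × S)) : EventuallyInjective (SheetChain U l) := by
  induction l with
  | nil =>
    refine ⟨0, ?_⟩
    rintro n - y z y' z' rfl rfl h
    exact h
  | cons i l ih =>
    obtain ⟨M, hM⟩ := ih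
    obtain ⟨M', hM'⟩ := SheetStep.eventuallyInjective hU i
    refine ⟨max M M', ?_⟩
    rintro n hn y z y' z' ⟨w, hw, hwz⟩ ⟨w', hw', hwz'⟩ h
    exact hM n (le_of_max_le_left hn) _ _ _ _ hw hw'
      (hM' n (le_of_max_le_right hn) _ _ _ _ hwz hwz' h)

/-- Every nonempty open set around a regular point contains points over a dense set of the
bottom level. -/
theorem IsPlaque.exists_mem_proj_zero_mem (hf : MDifferentiable 𝓘(ℂ) 𝓘(ℂ) f) (hU : IsPlaque f U)
    {T : Set S} (hT : ∀ O, IsOpen O → O.Nonempty → O ⊆ level U 0 → (O ∩ T).Nonempty)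
    {y : PlaqueInverseLimit f} (hreg : IsRegularPoint f y) (hyU : y ∈ U)
    {O : Set (PlaqueInverseLimit f)} (hO : IsOpen O) (hy : y ∈ O) :
    ∃ w ∈ O, w ∈ U ∧ proj 0 w ∈ T := by
  choose 𝓑 _ hconn h𝓑 using hU.exists_countable_basis
  obtain ⟨M, D, -, P, hP, hyP, hPO⟩ := hU.exists_isSheet hf hconn h𝓑 hreg hyU hO hy
  have hsub : level P M ⊆ level U M := image_mono hP.subset
  have h1 := hU.isOpen_image_iterate (Nat.zero_le M) (hP.isOpen_level M le_rfl) hsub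
  obtain ⟨_, ⟨_, ⟨w, hw, rfl⟩, rfl⟩, hwT⟩ := hT _ h1
    ((Nonempty.image _ ⟨y, hyP⟩).image _)
    ((image_mono hsub).trans (mapsTo_iterate_level U (Nat.zero_le M)).image_subset)
  rw [iterate_proj w (Nat.zero_le M)] at hwT
  exact ⟨w, hPO hw, hP.subset hw, hwT⟩

/-- A connected set of regular points of a plaque is traversed by chains of sheets taken from a
countable family. -/
theorem IsPlaque.exists_sheetChain (hf : MDifferentiable 𝓘(ℂ) 𝓘(ℂ) f) (hU : IsPlaque f U)
    {𝓑 : ℕ → Set (Set S)} (hconn : ∀ n, ∀ D ∈ 𝓑 n, IsPreconnected D)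
    (h𝓑 : ∀ n, ∀ O, IsOpen O → ∀ u ∈ O, u ∈ level U n → ∃ D ∈ 𝓑 n, IsOpen D ∧ u ∈ D ∧ D ⊆ O)
    {T : Set S} (hT : ∀ O, IsOpen O → O.Nonempty → O ⊆ level U 0 → (O ∩ T).Nonempty)
    {W : Set (PlaqueInverseLimit f)} (hW : IsOpen W) (hWU : W ⊆ U)
    (hreg : ∀ y ∈ W, IsRegularPoint f y)
    {K : Set (PlaqueInverseLimit f)} (hK : IsPreconnected K) (hKW : K ⊆ W)
    {y : PlaqueInverseLimit f} (hy : y ∈ K)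
    (hyT : proj 0 y ∈ T) {z : PlaqueInverseLimit f} (hz : z ∈ K) :
    ∃ l : List (ℕ × Set S × S),
      (∀ i ∈ l, i.2.1 ∈ 𝓑 i.1 ∧ i.2.2 ∈ level U i.1 ∧ f^[i.1] i.2.2 ∈ T) ∧
      ∃ P, IsOpen P ∧ z ∈ P ∧ ∀ w ∈ P, SheetChain U l y w := by
  let good : Set (List (ℕ × Set S × S)) :=
    {l | ∀ i ∈ l, i.2.1 ∈ 𝓑 i.1 ∧ i.2.2 ∈ level U i.1 ∧ f^[i.1] i.2.2 ∈ T}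
  let C : Set (PlaqueInverseLimit f) :=
    {z | ∃ l ∈ good, ∃ P, IsOpen P ∧ z ∈ P ∧ ∀ w ∈ P, SheetChain U l y w}
  -- A chain to a point above `T` extends to every point of a sheet around that point.
  have hext : ∀ l ∈ good, ∀ w v, SheetChain U l y w → w ∈ U → proj 0 w ∈ T → ∀ M, ∀ D ∈ 𝓑 M,
      ∀ P, IsSheet U M D P → w ∈ P → v ∈ P → v ∈ C := by
    intro l hl w v hlw hwU hwT M D hD P hP hwP hvP
    refine ⟨(M, D, proj M w) :: l, ?_, P, hP.isOpen, hvP,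
      fun v' hv' => ⟨w, hlw, P, hP, hwP, hv', rfl⟩⟩
    intro i hi
    rcases List.mem_cons.1 hi with rfl | hi
    · exact ⟨hD, proj_mem_level hwU M, by
        have := iterate_proj w (Nat.zero_le M)
        rw [Nat.sub_zero] at this
        exact this ▸ hwT⟩
    · exact hl i hi
  have hCo : IsOpen C := by
    refine isOpen_iff_forall_mem_open.2 ?_
    rintro z ⟨l, hl, P, hP, hzP, hw⟩
    exact ⟨P, fun v hv => ⟨l, hl, P, hP, hv, hw⟩, hP, hzP⟩
  -- The set reached by chains is open and relatively closed in `K`.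
  refine hK.subset_of_closure_inter_subset hCo ⟨y, hy, ?_⟩ ?_ hz
  · obtain ⟨M, D, hD, P, hP, hyP, -⟩ :=
      hU.exists_isSheet hf hconn h𝓑 (hreg y (hKW hy)) (hWU (hKW hy)) isOpen_univ (mem_univ y)
    exact hext [] (by simp [good]) y y rfl (hWU (hKW hy)) hyT M D hD P hP hyP hyP
  · rintro v ⟨hvC, hvK⟩
    obtain ⟨M, D, hD, P, hP, hvP, hPW⟩ :=
      hU.exists_isSheet hf hconn h𝓑 (hreg v (hKW hvK)) (hWU (hKW hvK)) hW (hKW hvK)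
    obtain ⟨w, hwP, l, hl, P', hP', hwP', hch⟩ := mem_closure_iff.1 hvC P hP.isOpen hvP
    obtain ⟨w', hw', hw'U, hw'T⟩ := hU.exists_mem_proj_zero_mem hf hT (hreg w (hPW hwP))
      (hWU (hPW hwP)) (hP.isOpen.inter hP') ⟨hwP, hwP'⟩
    exact hext l hl w' v (hch w' hw'.2) hw'U hw'T M D hD P hP hw'.1 hvP

end Chain

/-! ### Counting points in fibers -/

theorem Complex.finite_setOf_pow_eq {t : ℕ} (ht : 1 ≤ t) (a : ℂ) : {w : ℂ | w ^ t = a}.Finite := by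
  classical
  refine (Polynomial.nthRoots t a).toFinset.finite_toSet.subset fun w hw => ?_
  simpa [Polynomial.mem_nthRoots (by omega : 0 < t)] using hw

theorem Complex.ncard_setOf_pow_eq {t : ℕ} (ht : 1 ≤ t) (a : ℂ) :
    {w : ℂ | w ^ t = a}.ncard ≤ t ∧ (a ≠ 0 → {w : ℂ | w ^ t = a}.ncard = t) := by
  classical
  have h1 : {w : ℂ | w ^ t = a} = ((Polynomial.nthRoots t a).toFinset : Set ℂ) := by
    ext w
    simp [Polynomial.mem_nthRoots (by omega : 0 < t)]
  have hζ := Complex.isPrimitiveRoot_exp t (by omega)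
  rw [h1, ncard_coe_finset]
  refine ⟨(Multiset.toFinset_card_le _).trans (Polynomial.card_nthRoots t a), fun ha => ?_⟩
  rw [Multiset.toFinset_card_of_nodup (hζ.nthRoots_nodup ha), hζ.card_nthRoots, if_pos]
  exact IsAlgClosed.exists_pow_nat_eq a (by omega)

theorem Set.finite_and_ncard_le_mul {α β : Type*} {A : Set α} {B : Set β} {g : α → β} {t : ℕ}
    (hg : MapsTo g A B) (hB : B.Finite) (hfin : ∀ b ∈ B, (A ∩ g ⁻¹' {b}).Finite)
    (hle : ∀ b ∈ B, (A ∩ g ⁻¹' {b}).ncard ≤ t) : A.Finite ∧ A.ncard ≤ t * B.ncard := by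
  classical
  have hA : A.Finite := by
    refine (hB.biUnion hfin).subset fun a ha => mem_biUnion (hg ha) ⟨ha, rfl⟩
  refine ⟨hA, ?_⟩
  lift A to Finset α using hA
  lift B to Finset β using hB
  rw [ncard_coe_finset, ncard_coe_finset]
  refine Finset.card_le_mul_card_image_of_maps_to (fun a ha => hg ha) t fun b hb => ?_
  have := hle b hb
  rw [show (A : Set α) ∩ g ⁻¹' {b} = ((A.filter fun a => g a = b : Finset α) : Set α) by
    ext; simp, ncard_coe_finset] at this
  exact this

theorem Set.mul_ncard_le_ncard {α β : Type*} {A : Set α} {B : Set β} {g : α → β} {t : ℕ}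
    (hg : MapsTo g A B) (hA : A.Finite) (hB : B.Finite)
    (hle : ∀ b ∈ B, t ≤ (A ∩ g ⁻¹' {b}).ncard) : t * B.ncard ≤ A.ncard := by
  classical
  lift A to Finset α using hA
  lift B to Finset β using hB
  rw [ncard_coe_finset, ncard_coe_finset]
  refine Finset.mul_card_image_le_card_of_maps_to (fun a ha => hg ha) t fun b hb => ?_
  have := hle b hb
  rw [show (A : Set α) ∩ g ⁻¹' {b} = ((A.filter fun a => g a = b : Finset α) : Set α) by
    ext; simp, ncard_coe_finset] at this
  exact this

theorem PlaqueInverseLimit.mapsTo_iterate_fiber {S : Type*} {f : S → S}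
    (U : Set (PlaqueInverseLimit f)) {m n : ℕ} (hmn : m ≤ n) (u : S) :
    MapsTo f (level U (n + 1) ∩ f^[n + 1 - m] ⁻¹' {u}) (level U n ∩ f^[n - m] ⁻¹' {u}) := by
  rintro v ⟨hv, hvu⟩
  rw [Nat.succ_sub hmn, mem_preimage, Function.iterate_succ_apply] at hvu
  exact ⟨mapsTo_level U n hv, hvu⟩

theorem PlaqueInverseLimit.inter_fiber_eq {S : Type*} {f : S → S}
    (U : Set (PlaqueInverseLimit f)) {m n : ℕ} (hmn : m ≤ n) {u a : S}
    (ha : a ∈ level U n ∩ f^[n - m] ⁻¹' {u}) :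
    level U (n + 1) ∩ f^[n + 1 - m] ⁻¹' {u} ∩ f ⁻¹' {a} = level U (n + 1) ∩ f ⁻¹' {a} := by
  refine Subset.antisymm (fun v hv => ⟨hv.1.1, hv.2⟩) fun v hv => ⟨⟨hv.1, ?_⟩, hv.2⟩
  rw [Nat.succ_sub hmn, mem_preimage, Function.iterate_succ_apply, show f v = a from hv.2]
  exact ha.2

section Degree

variable {S : Type*} [TopologicalSpace S] [ChartedSpace ℂ S] {f : S → S}

/-- `t n` is the degree of `f` from level `n + 1` to level `n` of `U`: the number of preimages of
every point of level `n` but one, the possible critical value. -/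
structure IsDegreeSequence (U : Set (PlaqueInverseLimit f)) (t : ℕ → ℕ) : Prop where
  one_le : ∀ n, 1 ≤ t n
  finite_fiber : ∀ n v, (level U (n + 1) ∩ f ⁻¹' {v}).Finite
  ncard_fiber_le : ∀ n v, (level U (n + 1) ∩ f ⁻¹' {v}).ncard ≤ t n
  exists_ncard_fiber_eq : ∀ n, ∃ e, ∀ v ∈ level U n, v ≠ e →
    (level U (n + 1) ∩ f ⁻¹' {v}).ncard = t n
  eq_one_iff : ∀ n, t n = 1 ↔ ∀ u ∈ level U (n + 1), ¬ IsCriticalPoint f u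
  eq_of_isCriticalPoint : ∀ n, ∀ u ∈ level U (n + 1), ∀ u' ∈ level U (n + 1),
    IsCriticalPoint f u → IsCriticalPoint f u' → u = u'

theorem IsPlaque.exists_isDegreeSequence [IsManifold 𝓘(ℂ) 1 S]
    (hf : MDifferentiable 𝓘(ℂ) 𝓘(ℂ) f) {U : Set (PlaqueInverseLimit f)} (hU : IsPlaque f U) :
    ∃ t, IsDegreeSequence U t := by
  have key : ∀ n, ∃ t : ℕ, 1 ≤ t ∧ (∀ v, (level U (n + 1) ∩ f ⁻¹' {v}).Finite) ∧
      (∀ v, (level U (n + 1) ∩ f ⁻¹' {v}).ncard ≤ t) ∧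
      (∃ e, ∀ v ∈ level U n, v ≠ e → (level U (n + 1) ∩ f ⁻¹' {v}).ncard = t) ∧
      (t = 1 ↔ ∀ u ∈ level U (n + 1), ¬ IsCriticalPoint f u) ∧
      (∀ u ∈ level U (n + 1), ∀ u' ∈ level U (n + 1),
        IsCriticalPoint f u → IsCriticalPoint f u' → u = u') := by
    intro n
    obtain ⟨t, ht, φ, ψ, hφ, hψ, hc⟩ := hU.conj_pow n
    have hcrit : ∀ u ∈ level U (n + 1), IsCriticalPoint f u ↔ t ≠ 1 ∧ φ u = 0 := fun u hu =>
      isCriticalPoint_iff_of_conj_pow hf hφ hψ (mapsTo_level U n) ht hc hu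
    have hsub : ∀ v, φ '' (level U (n + 1) ∩ f ⁻¹' {v}) ⊆ {w : ℂ | w ^ t = ψ v} := by
      rintro v _ ⟨u, ⟨hu, rfl⟩, rfl⟩
      exact (hc u hu).symm
    have hinj : ∀ v, InjOn φ (level U (n + 1) ∩ f ⁻¹' {v}) := fun v =>
      hφ.bijOn.injOn.mono inter_subset_left
    obtain ⟨z, hz, hz0⟩ := hφ.bijOn.surjOn (Metric.mem_ball_self one_pos)
    obtain ⟨e, he, he0⟩ := hψ.bijOn.surjOn (Metric.mem_ball_self one_pos)
    refine ⟨t, ht, fun v => ?_, fun v => ?_, ⟨e, fun v hv hve => ?_⟩, ?_, ?_⟩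
    · exact ((Complex.finite_setOf_pow_eq ht _).subset (hsub v)).of_finite_image (hinj v)
    · rw [← (hinj v).ncard_image]
      exact (ncard_le_ncard (hsub v) (Complex.finite_setOf_pow_eq ht _)).trans
        (Complex.ncard_setOf_pow_eq ht _).1
    · have hv0 : ψ v ≠ 0 := fun h => hve (hψ.bijOn.injOn hv he (h.trans he0.symm))
      rw [← (hinj v).ncard_image, ← (Complex.ncard_setOf_pow_eq ht (ψ v)).2 hv0]
      congr 1
      refine (hsub v).antisymm fun w hw => ?_
      have hw1 : w ∈ Metric.ball (0 : ℂ) 1 := by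
        have h1 := hψ.bijOn.mapsTo hv
        rw [mem_ball_zero_iff, ← show w ^ t = ψ v from hw, norm_pow] at h1
        rw [mem_ball_zero_iff]
        exact (pow_lt_one_iff_of_nonneg (norm_nonneg w) (by omega)).1 h1
      obtain ⟨u, hu, rfl⟩ := hφ.bijOn.surjOn hw1
      refine ⟨u, ⟨hu, ?_⟩, rfl⟩
      exact hψ.bijOn.injOn (mapsTo_level U n hu) hv ((hc u hu).trans hw)
    · constructor
      · intro h u hu hcu
        exact ((hcrit u hu).1 hcu).1 h
      · intro h
        by_contra ht1
        exact h z hz ((hcrit z hz).2 ⟨ht1, hz0⟩)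
    · intro u hu u' hu' h h'
      exact hφ.bijOn.injOn hu hu'
        (((hcrit u hu).1 h).2.trans ((hcrit u' hu').1 h').2.symm)
  choose t h1 h2 h3 h4 h5 h6 using key
  exact ⟨t, h1, h2, h3, h4, h5, h6⟩

theorem IsPlaque.not_countable_level {U : Set (PlaqueInverseLimit f)} (hU : IsPlaque f U) (n : ℕ) :
    ¬ (level U n).Countable := by
  obtain ⟨t, -, φ, ψ, -, hψ, -⟩ := hU.conj_pow n
  intro h
  have h1 : (Metric.ball (0 : ℂ) 1).Countable := hψ.bijOn.image_eq ▸ h.image ψ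
  obtain ⟨w, hw, hw'⟩ := (h1.dense_compl ℂ).inter_open_nonempty _ Metric.isOpen_ball
    ⟨0, Metric.mem_ball_self one_pos⟩
  exact hw' hw

namespace IsDegreeSequence

variable {U : Set (PlaqueInverseLimit f)} {t : ℕ → ℕ}

theorem finite_and_ncard_iterate_fiber_le (ht : IsDegreeSequence U t) {m n : ℕ} (hmn : m ≤ n)
    (u : S) : (level U n ∩ f^[n - m] ⁻¹' {u}).Finite ∧
      (level U n ∩ f^[n - m] ⁻¹' {u}).ncard ≤ ∏ l ∈ Finset.Ico m n, t l := by
  induction n, hmn using Nat.le_induction with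
  | base =>
    have : level U m ∩ f^[m - m] ⁻¹' {u} ⊆ {u} := by
      rintro v ⟨-, hv⟩
      simpa using hv
    refine ⟨(finite_singleton u).subset this, ?_⟩
    simpa using ncard_le_ncard this
  | succ n hmn ih =>
    obtain ⟨h1, h2⟩ := finite_and_ncard_le_mul (mapsTo_iterate_fiber U hmn u) ih.1
      (fun a ha => by rw [inter_fiber_eq U hmn ha]; exact ht.finite_fiber n a)
      (fun a ha => by rw [inter_fiber_eq U hmn ha]; exact ht.ncard_fiber_le n a)
    refine ⟨h1, h2.trans ?_⟩
    rw [Finset.prod_Ico_succ_top hmn, mul_comm]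
    exact Nat.mul_le_mul_right _ ih.2

theorem prod_le_ncard_iterate_fiber (ht : IsDegreeSequence U t) {m n : ℕ} (hmn : m ≤ n)
    {u : S} (hu : u ∈ level U m)
    (hgen : ∀ l, m ≤ l → ∀ v ∈ level U l, f^[l - m] v = u →
      (level U (l + 1) ∩ f ⁻¹' {v}).ncard = t l) :
    ∏ l ∈ Finset.Ico m n, t l ≤ (level U n ∩ f^[n - m] ⁻¹' {u}).ncard := by
  induction n, hmn using Nat.le_induction with
  | base =>
    have : level U m ∩ f^[m - m] ⁻¹' {u} = {u} := by
      refine Subset.antisymm ?_ ?_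
      · rintro v ⟨-, hv⟩
        simpa using hv
      · rintro v rfl
        exact ⟨hu, by simp⟩
    rw [this]
    simp
  | succ n hmn ih =>
    have := mul_ncard_le_ncard (mapsTo_iterate_fiber U hmn u)
      (ht.finite_and_ncard_iterate_fiber_le (hmn.trans n.le_succ) u).1
      (ht.finite_and_ncard_iterate_fiber_le hmn u).1 (t := t n)
      (fun a ha => by rw [inter_fiber_eq U hmn ha, hgen n hmn a ha.1 ha.2])
    refine le_trans ?_ this
    rw [Finset.prod_Ico_succ_top hmn, mul_comm]
    exact Nat.mul_le_mul_left _ ih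

theorem le_of_subset {N : Set (PlaqueInverseLimit f)} {s : ℕ → ℕ} (ht : IsDegreeSequence U t)
    (hN : IsPlaque f N) (hs : IsDegreeSequence N s) (hNU : N ⊆ U) (n : ℕ) : s n ≤ t n := by
  obtain ⟨e, he⟩ := hs.exists_ncard_fiber_eq n
  obtain ⟨v, hv, hve⟩ : ∃ v ∈ level N n, v ≠ e := by
    by_contra! h
    exact hN.not_countable_level n ((countable_singleton e).mono h)
  rw [← he v hv hve]
  exact (ncard_le_ncard (inter_subset_inter_left _ (image_mono hNU)) (ht.finite_fiber n v)).trans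
    (ht.ncard_fiber_le n v)

/-- A critical point that lies in a level of a plaque but not in that of a smaller one makes the
degree drop to `1` there. -/
theorem eq_one_and_two_le {N : Set (PlaqueInverseLimit f)} {s : ℕ → ℕ} (ht : IsDegreeSequence U t)
    (hs : IsDegreeSequence N s) (hNU : N ⊆ U) {c : S} (hc : IsCriticalPoint f c) {n : ℕ}
    (hcU : c ∈ level U (n + 1)) (hcN : c ∉ level N (n + 1)) : s n = 1 ∧ 2 ≤ t n := by
  constructor
  · refine (hs.eq_one_iff n).2 fun u hu hcu => hcN ?_
    rwa [← ht.eq_of_isCriticalPoint n u (image_mono hNU hu) c hcU hcu hc]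
  · have h1 := ht.one_le n
    have h2 : t n ≠ 1 := fun h => (ht.eq_one_iff n).1 h c hcU hc
    omega

/-- All but countably many points of a level have the generic number of preimages at every
higher level. -/
theorem exists_countable_generic (ht : IsDegreeSequence U t) :
    ∃ E : Set S, E.Countable ∧ ∀ p ∉ E, ∀ l, ∀ v ∈ level U l, f^[l] v = p →
      (level U (l + 1) ∩ f ⁻¹' {v}).ncard = t l := by
  choose e he using ht.exists_ncard_fiber_eq
  refine ⟨range fun l => f^[l] (e l), countable_range _, fun p hp l v hv hvp => ?_⟩
  refine he l v hv ?_
  rintro rfl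
  exact hp ⟨l, hvp⟩

end IsDegreeSequence

end Degree

/-- If the degrees `s` drop below the degrees `t` infinitely often, then the products of the `t`
from any index on outgrow the full products of the `s`. -/
theorem exists_prod_lt_prod {s t : ℕ → ℕ} (hs : ∀ n, 1 ≤ s n) (hst : ∀ n, s n ≤ t n)
    (hinf : {n | s n = 1 ∧ 2 ≤ t n}.Infinite) (m M : ℕ) :
    ∃ n, m ≤ n ∧ M ≤ n ∧ ∏ l ∈ Finset.Ico 0 n, s l < ∏ l ∈ Finset.Ico m n, t l := by
  have key : ∀ k, ∃ n, m ≤ n ∧ ∀ n', n ≤ n' →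
      2 ^ k * ∏ l ∈ Finset.Ico m n', s l ≤ ∏ l ∈ Finset.Ico m n', t l := by
    intro k
    induction k with
    | zero =>
      refine ⟨m, le_rfl, fun n' _ => ?_⟩
      rw [pow_zero, one_mul]
      exact Finset.prod_le_prod' fun l _ => hst l
    | succ k ih =>
      obtain ⟨n, hmn, hn⟩ := ih
      obtain ⟨i, ⟨hsi, hti⟩, hi⟩ := hinf.exists_gt n
      refine ⟨i + 1, by omega, fun n' hn' => ?_⟩
      induction n', hn' using Nat.le_induction with
      | base =>
        rw [Finset.prod_Ico_succ_top (by omega), Finset.prod_Ico_succ_top (by omega), hsi, mul_one,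
          pow_succ, mul_right_comm]
        exact Nat.mul_le_mul (hn i hi.le) hti
      | succ j hj ih =>
        rw [Finset.prod_Ico_succ_top (by omega), Finset.prod_Ico_succ_top (by omega), ← mul_assoc]
        exact Nat.mul_le_mul ih (hst j)
  obtain ⟨n, hmn, hn⟩ := key (∏ l ∈ Finset.Ico 0 m, s l)
  refine ⟨max n M, hmn.trans (le_max_left _ _), le_max_right _ _, ?_⟩
  rw [← Finset.prod_Ico_consecutive s (Nat.zero_le m) (hmn.trans (le_max_left n M))]
  refine lt_of_lt_of_le ?_ (hn _ (le_max_left n M))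
  exact Nat.mul_lt_mul_of_pos_right Nat.lt_two_pow_self (Finset.prod_pos fun l _ => hs l)

/-! ### Nowhere dense subsets of a fiber -/

/-- `A` is nowhere dense among the points of `N` above `p`: every coordinate of such a point is also
the coordinate of such a point `w'` which differs, at some level `n`, from all points of `A`. As a
coordinate determines the lower ones, the coordinates at a level index a basis of the fiber. -/
def IsNowhereDenseAbove {S : Type*} {f : S → S} (N : Set (PlaqueInverseLimit f)) (p : S)
    (A : Set (PlaqueInverseLimit f)) : Prop :=
  ∀ m, ∀ w ∈ N, proj 0 w = p → ∃ n, ∃ w' ∈ N, proj m w' = proj m w ∧ proj n w' ∉ proj n '' A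

theorem PlaqueInverseLimit.proj_eq_of_le {S : Type*} {f : S → S} {w w' : PlaqueInverseLimit f}
    {m n : ℕ} (hmn : m ≤ n) (h : proj n w = proj n w') : proj m w = proj m w' := by
  rw [← iterate_proj w hmn, ← iterate_proj w' hmn, h]

/-- The Baire category theorem for the fiber over `p`. -/
theorem IsNowhereDenseAbove.exists_forall_notMem {S : Type*} {f : S → S}
    {N : Set (PlaqueInverseLimit f)} (hN : N = {x | ∀ n, proj n x ∈ level N n}) {p : S}
    (hp : p ∈ level N 0) {A : ℕ → Set (PlaqueInverseLimit f)}
    (hA : ∀ i, IsNowhereDenseAbove N p (A i)) : ∃ y ∈ N, proj 0 y = p ∧ ∀ i, y ∉ A i := by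
  have step : ∀ i (q : ℕ × {w : PlaqueInverseLimit f // w ∈ N ∧ proj 0 w = p}),
      ∃ q' : ℕ × {w : PlaqueInverseLimit f // w ∈ N ∧ proj 0 w = p},
        q.1 < q'.1 ∧ proj q.1 q'.2.1 = proj q.1 q.2.1 ∧ proj q'.1 q'.2.1 ∉ proj q'.1 '' A i := by
    rintro i ⟨m, w, hw, hwp⟩
    obtain ⟨n, w', hw', hww, hn⟩ := hA i m w hw hwp
    refine ⟨⟨max (m + 1) n, w', hw', ?_⟩, by simp, hww, ?_⟩
    · exact (proj_eq_of_le (Nat.zero_le m) hww).trans hwp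
    · rintro ⟨a, ha, h⟩
      exact hn ⟨a, ha, proj_eq_of_le (le_max_right _ _) h⟩
  choose next h1 h2 h3 using step
  obtain ⟨w₀, hw₀, hw₀p⟩ := hp
  let q : ℕ → ℕ × {w : PlaqueInverseLimit f // w ∈ N ∧ proj 0 w = p} :=
    fun n => Nat.rec (0, ⟨w₀, hw₀, hw₀p⟩) next n
  have hmono : StrictMono fun i => (q i).1 := strictMono_nat_of_lt_succ fun i => h1 i (q i)
  have hle : ∀ i, i ≤ (q i).1 := fun _ => hmono.le_apply
  have hcoh : ∀ {i j}, i ≤ j → proj (q i).1 (q j).2.1 = proj (q i).1 (q i).2.1 := by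
    intro i j hij
    induction j, hij using Nat.le_induction with
    | base => rfl
    | succ j hij ih =>
      exact (proj_eq_of_le (hmono.monotone hij) (h2 j (q j))).trans ih
  -- The limit point shares the initial segment of length `(q i).1` with the `i`-th point.
  let y : PlaqueInverseLimit f := ⟨fun n => proj n (q n).2.1, fun n => by
    change f (proj (n + 1) (q (n + 1)).2.1) = _
    rw [apply_proj_succ (q (n + 1)).2.1]
    exact proj_eq_of_le (hle n) (hcoh n.le_succ)⟩
  have hy : ∀ i, proj (q i).1 y = proj (q i).1 (q i).2.1 := fun i => hcoh (hle i)
  refine ⟨y, ?_, (q 0).2.2.2, fun i hi => ?_⟩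
  · rw [hN]
    exact fun n => ⟨(q n).2.1, (q n).2.2.1, rfl⟩
  · exact h3 i (q i) ⟨y, hi, hy (i + 1)⟩

/-- If the levels of `A` have fewer points than the levels of the fiber of `N` over any point of
the fiber over `p`, then `A` is nowhere dense in the fiber over `p`. -/
theorem IsDegreeSequence.isNowhereDenseAbove {S : Type*} [TopologicalSpace S] [ChartedSpace ℂ S]
    {f : S → S} {N : Set (PlaqueInverseLimit f)} {t : ℕ → ℕ} (ht : IsDegreeSequence N t) {p : S}
    (hgen : ∀ l, ∀ v ∈ level N l, f^[l] v = p → (level N (l + 1) ∩ f ⁻¹' {v}).ncard = t l)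
    {A : Set (PlaqueInverseLimit f)}
    (hA : ∀ m, ∃ n, m ≤ n ∧ (proj n '' A).Finite ∧
      (proj n '' A).ncard < ∏ l ∈ Finset.Ico m n, t l) : IsNowhereDenseAbove N p A := by
  intro m w hw hwp
  obtain ⟨n, hmn, hfin, hlt⟩ := hA m
  have h1 := ht.prod_le_ncard_iterate_fiber hmn (proj_mem_level hw m) (by
    intro l hl v hv hvw
    refine hgen l v hv ?_
    have h2 := iterate_proj w (Nat.zero_le m)
    rwa [← hvw, ← Function.iterate_add_apply, show m - 0 + (l - m) = l by omega, hwp] at h2)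
  obtain ⟨_, ⟨⟨w', hw', rfl⟩, h⟩, hnot⟩ :=
    exists_mem_notMem_of_ncard_lt_ncard (hlt.trans_le h1) hfin
  refine ⟨n, w', hw', ?_, hnot⟩
  rw [mem_preimage, iterate_proj w' hmn] at h
  exact h

/-- Along an eventually injective relation, few targets have few sources. -/
theorem EventuallyInjective.ncard_image_le {S : Type*} {f : S → S}
    {R : PlaqueInverseLimit f → PlaqueInverseLimit f → Prop} (hR : EventuallyInjective R)
    (Z : Set (PlaqueInverseLimit f)) : ∃ M, ∀ n, M ≤ n → (proj n '' Z).Finite →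
      (proj n '' {y | ∃ z ∈ Z, R y z}).Finite ∧
      (proj n '' {y | ∃ z ∈ Z, R y z}).ncard ≤ (proj n '' Z).ncard := by
  obtain ⟨M, hM⟩ := hR
  refine ⟨M, fun n hn hfin => ?_⟩
  have key : ∀ u ∈ proj n '' {y | ∃ z ∈ Z, R y z}, ∃ v ∈ proj n '' Z,
      ∃ y z, R y z ∧ proj n y = u ∧ proj n z = v := by
    rintro _ ⟨y, ⟨z, hz, hyz⟩, rfl⟩
    exact ⟨_, mem_image_of_mem _ hz, y, z, hyz, rfl, rfl⟩
  choose! g hg using key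
  have hinj : InjOn g (proj n '' {y | ∃ z ∈ Z, R y z}) := by
    intro u hu u' hu' h
    obtain ⟨y, z, hyz, rfl, hz⟩ := (hg u hu).2
    obtain ⟨y', z', hyz', rfl, hz'⟩ := (hg u' hu').2
    exact hM n hn y z y' z' hyz hyz' (hz.trans (h.trans hz'.symm))
  have hmaps : MapsTo g (proj n '' {y | ∃ z ∈ Z, R y z}) (proj n '' Z) := fun u hu => (hg u hu).1
  exact ⟨Finite.of_injOn hmaps hinj hfin, ncard_le_ncard_of_injOn g hmaps hinj hfin⟩

/-! ### Paths that reach a point -/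

/-- A path ending at `x` enters every neighborhood of `x` before it hits `x` for the first time. -/
theorem JoinedIn.exists_isPreconnected {X : Type*} [TopologicalSpace X] [T1Space X] {V N : Set X}
    {x y : X} (h : JoinedIn V y x) (hyx : y ≠ x) (hN : N ∈ 𝓝 x) :
    ∃ K, IsPreconnected K ∧ K ⊆ V \ {x} ∧ y ∈ K ∧ (K ∩ N).Nonempty := by
  obtain ⟨γ, hγ⟩ := h
  let s : Set ℝ := Icc 0 1 ∩ γ.extend ⁻¹' {x}
  have hs : IsClosed s := isClosed_Icc.inter (isClosed_singleton.preimage γ.continuous_extend)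
  have hbdd : BddBelow s := ⟨0, fun t ht => ht.1.1⟩
  have hmem : sInf s ∈ s := hs.csInf_mem ⟨1, by simp, by simp⟩ hbdd
  set τ := sInf s
  have hτ0 : 0 < τ := by
    refine lt_of_le_of_ne hmem.1.1 fun h0 => hyx ?_
    have := hmem.2
    rw [← h0] at this
    simpa using this
  have hnear : γ.extend ⁻¹' N ∈ 𝓝 τ :=
    γ.continuous_extend.continuousAt (by rw [show γ.extend τ = x from hmem.2]; exact hN)
  obtain ⟨l, hl, hsub⟩ := exists_Ioc_subset_of_mem_nhds hnear ⟨0, hτ0⟩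
  obtain ⟨t, ht, htτ⟩ := exists_between (max_lt hl hτ0)
  refine ⟨γ.extend '' Icc 0 t, isPreconnected_Icc.image _ γ.continuous_extend.continuousOn,
    ?_, ⟨0, ⟨le_rfl, (le_max_right l 0).trans ht.le⟩, by simp⟩, γ.extend t,
    ⟨t, ⟨(le_max_right l 0).trans ht.le, le_rfl⟩, rfl⟩,
    hsub ⟨(le_max_left l 0).trans_lt ht, htτ.le⟩⟩
  rintro _ ⟨r, hr, rfl⟩
  have hr1 : r ∈ Icc (0 : ℝ) 1 := ⟨hr.1, (hr.2.trans htτ.le).trans hmem.1.2⟩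
  refine ⟨?_, fun hx => ?_⟩
  · rw [γ.extend_apply hr1]
    exact hγ _
  · exact absurd (csInf_le hbdd ⟨hr1, hx⟩) (not_le.2 (hr.2.trans_lt htτ))

/-! ### Signatures without a maximal element -/

/-- If the signature has no maximal element, then the indices of shrinking plaques do not
stabilize. -/
theorem ShrinksTo.exists_infinite {S : Type*} [TopologicalSpace S] [ChartedSpace ℂ S] {f : S → S}
    {N : ℕ → Set (PlaqueInverseLimit f)} {x : PlaqueInverseLimit f} (hN : ShrinksTo N x) {c : S}
    (hmax : ¬ HasMaximalElement (⋂ j, alpha (index (N j) c))) (j : ℕ) :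
    ∃ k, N k ⊆ N j ∧ {n | c ∈ level (N j) n ∧ c ∉ level (N k) n}.Infinite := by
  have hanti : Antitone N := antitone_nat_of_succ_le hN.succ_subset
  have h1 : ∃ k, ¬ index (N j) c ≤ index (N k) c := by
    by_contra! h
    refine hmax ⟨index (N j) c, Subset.antisymm (iInter_subset _ j) ?_⟩
    exact subset_iInter fun k b hb => le_trans hb (h k)
  obtain ⟨k, hk⟩ := h1
  refine ⟨k, ?_, ?_⟩
  · rcases le_total j k with h | h
    · exact hanti h
    · exact (hk (index_mono (hanti h) c)).elim
  · rw [← frequently_cofinite_iff_infinite]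
    intro h
    refine hk (Germ.coe_le.2 (h.mono fun n hn hc => ?_))
    by_contra hc'
    exact hn ⟨hc, hc'⟩

/-! ### Uncountably many path components -/

theorem mainTheorem5 {S : Type*} [TopologicalSpace S] [ChartedSpace ℂ S] [IsManifold 𝓘(ℂ) 1 S]
    [T2Space S] [SimplyConnectedSpace S]
    (f : S → S) (d : ℕ) (hd : 1 < d) (hf : IsBranchedCovering f d)
    (x : PlaqueInverseLimit f) (hx : IsIsolatedIrregularPoint f x)
    (c : S) (hc : IsCriticalPoint f c)
    (σ : Set BinaryClass) (hσ : IsSignature x c σ) (hmax : ¬ HasMaximalElement σ) :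
    ∃ U : Set (PlaqueInverseLimit f), IsPlaque f U ∧ x ∈ U ∧
      ∀ V : Set (PlaqueInverseLimit f), IsOpen V → x ∈ V → V ⊆ U →
        Uncountable (ZerothHomotopy V) := by
  have hfm := hf.holomorphic
  obtain ⟨N, hN, rfl⟩ := hσ
  obtain ⟨-, W, hW, hxW, hreg⟩ := hx
  obtain ⟨i₀, hi₀⟩ := hN.exists_subset W hW hxW
  generalize hU' : N i₀ = U at hi₀
  have hU : IsPlaque f U := hU' ▸ hN.isPlaque i₀
  refine ⟨U, hU, hU' ▸ hN.mem i₀, fun V hV hxV hVU => ?_⟩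
  rw [← not_countable_iff]
  intro hcount
  obtain ⟨j, hj⟩ := hN.exists_subset V hV hxV
  obtain ⟨k, hkj, hinf⟩ := hN.exists_infinite hmax j
  obtain ⟨r, hr⟩ := hU.exists_isDegreeSequence hfm
  obtain ⟨t, ht⟩ := (hN.isPlaque j).exists_isDegreeSequence hfm
  obtain ⟨s, hs⟩ := (hN.isPlaque k).exists_isDegreeSequence hfm
  have hinf' : {n | s n = 1 ∧ 2 ≤ t n}.Infinite := by
    intro hfin
    -- The degree at `n` concerns level `n + 1`, so level `0` is set aside.
    refine hinf (((hfin.image Nat.succ).insert 0).subset ?_)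
    rintro (_ | n) ⟨h1, h2⟩
    · exact mem_insert _ _
    · exact Or.inr ⟨n, ht.eq_one_and_two_le hs hkj hc h1 h2, rfl⟩
  have hst := ht.le_of_subset (hN.isPlaque k) hs hkj
  -- A generic base point: not a critical value of any iterate, and not below `x`.
  obtain ⟨E, hE, hgen⟩ := ht.exists_countable_generic
  obtain ⟨p, hp, hpE⟩ : ∃ p ∈ level (N j) 0, p ∉ E ∪ {proj 0 x} := by
    by_contra! h
    exact (hN.isPlaque j).not_countable_level 0 ((hE.union (countable_singleton _)).mono h)
  choose 𝓑 h𝓑c hconn h𝓑 using hU.exists_countable_basis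
  obtain ⟨T₀, hT₀, hT₀d⟩ := hU.exists_countable_dense 0
  -- Chains may start over the points of a countable dense set that contains the base point.
  let T := insert p T₀
  have hTc : T.Countable := hT₀.insert p
  have hT : ∀ O, IsOpen O → O.Nonempty → O ⊆ level U 0 → (O ∩ T).Nonempty := fun O h1 h2 h3 =>
    (hT₀d O h1 h2 h3).mono (inter_subset_inter_right _ (subset_insert _ _))
  let I : Set (ℕ × Set S × S) :=
    {i | i.2.1 ∈ 𝓑 i.1 ∧ i.2.2 ∈ level U i.1 ∧ f^[i.1] i.2.2 ∈ T}
  have hI : I.Countable := by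
    have h1 : (⋃ M : ℕ, ({M} : Set ℕ) ×ˢ
        (𝓑 M ×ˢ ⋃ q ∈ T, level U M ∩ f^[M - 0] ⁻¹' {q})).Countable :=
      countable_iUnion fun M => (countable_singleton M).prod ((h𝓑c M).prod
        (hTc.biUnion fun q _ =>
          (hr.finite_and_ncard_iterate_fiber_le (Nat.zero_le M) q).1.countable))
    refine h1.mono ?_
    rintro ⟨M, D, q⟩ ⟨hD, hq, hqT⟩
    exact mem_iUnion.2 ⟨M, rfl, hD, mem_iUnion₂.2 ⟨_, hqT, hq, rfl⟩⟩
  have : Countable I := hI.to_subtype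
  have : Countable T := hTc.to_subtype
  let cls : V → ZerothHomotopy V := Quotient.mk (pathSetoid V)
  have hcls : ∀ {a b}, cls a = cls b ↔ Joined a b := Quotient.eq
  -- A representative above `p` of each path component that has one.
  have hrep : ∀ κ : ZerothHomotopy V, ∃ w : V,
      (∃ y : V, proj 0 y.1 = p ∧ cls y = κ) → proj 0 w.1 = p ∧ cls w = κ := by
    intro κ
    by_cases h : ∃ y : V, proj 0 y.1 = p ∧ cls y = κ
    · exact ⟨h.choose, fun _ => h.choose_spec⟩
    · exact ⟨⟨x, hxV⟩, fun h' => (h h').elim⟩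
  choose rep hrep using hrep
  -- The targets of chains: the part of `N k` above a point of `T`, or a single representative.
  let Z : T ⊕ ZerothHomotopy V → Set (PlaqueInverseLimit f) :=
    Sum.elim (fun q => {z ∈ N k | proj 0 z = q}) fun κ => {(rep κ).1}
  have hZ : ∀ i n, (proj n '' Z i).Finite ∧ (proj n '' Z i).ncard ≤ ∏ l ∈ Finset.Ico 0 n, s l := by
    rintro (q | κ) n
    · obtain ⟨h1, h2⟩ := hs.finite_and_ncard_iterate_fiber_le (Nat.zero_le n) q.1
      have h3 : proj n '' Z (Sum.inl q) ⊆ level (N k) n ∩ f^[n - 0] ⁻¹' {q.1} := by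
        rintro _ ⟨z, ⟨hz, hzq⟩, rfl⟩
        exact ⟨proj_mem_level hz n, by rw [mem_preimage, iterate_proj z (Nat.zero_le n)]; exact hzq⟩
      exact ⟨h1.subset h3, (ncard_le_ncard h3 h1).trans h2⟩
    · have h1 : proj n '' Z (Sum.inr κ) = {proj n (rep κ).1} := image_singleton
      rw [h1, ncard_singleton]
      exact ⟨finite_singleton _, Finset.one_le_prod' fun l _ => hs.one_le l⟩
  -- The sources, among all points, of a given chain type with a given kind of target.
  let A : List I × (T ⊕ ZerothHomotopy V) → Set (PlaqueInverseLimit f) := fun a =>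
    {y | ∃ z ∈ Z a.2, SheetChain U (a.1.map Subtype.val) y z}
  have hA : ∀ a, IsNowhereDenseAbove (N j) p (A a) := by
    intro a
    refine ht.isNowhereDenseAbove (hgen p fun h => hpE (Or.inl h)) fun m => ?_
    obtain ⟨M, hM⟩ :=
      (SheetChain.eventuallyInjective hU (a.1.map Subtype.val)).ncard_image_le (Z a.2)
    obtain ⟨n, hmn, hMn, hlt⟩ := exists_prod_lt_prod hs.one_le hst hinf' m M
    obtain ⟨h1, h2⟩ := hM n hMn (hZ a.2 n).1
    exact ⟨n, hmn, h1, (h2.trans (hZ a.2 n).2).trans_lt hlt⟩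
  have : Nonempty (List I × (T ⊕ ZerothHomotopy V)) := ⟨[], Sum.inr (cls ⟨x, hxV⟩)⟩
  obtain ⟨enum, henum⟩ := exists_surjective_nat (List I × (T ⊕ ZerothHomotopy V))
  obtain ⟨y, hyN, hyp, hyA⟩ := IsNowhereDenseAbove.exists_forall_notMem
    (hN.isPlaque j).eq_levels hp fun i => hA (enum i)
  replace hyA : ∀ a, y ∉ A a := fun a => by
    obtain ⟨i, rfl⟩ := henum a
    exact hyA i
  have hyx : y ≠ x := by
    rintro rfl
    exact hpE (Or.inr hyp.symm)
  have hO : IsOpen (U \ {x}) := hU.isOpen.sdiff isClosed_singleton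
  have hOreg : ∀ w ∈ U \ {x}, IsRegularPoint f w := fun w hw => hreg w (hi₀ hw.1) hw.2
  have hchain : ∀ K, IsPreconnected K → K ⊆ V \ {x} → y ∈ K → ∀ z ∈ K, ∃ l : List I,
      ∃ P, IsOpen P ∧ z ∈ P ∧ ∀ w ∈ P, SheetChain U (l.map Subtype.val) y w := by
    intro K hK hKV hyK z hzK
    obtain ⟨l, hl, h⟩ := hU.exists_sheetChain hfm hconn h𝓑 hT hO sdiff_subset hOreg hK
      (hKV.trans (sdiff_subset_sdiff_left hVU)) hyK (hyp ▸ mem_insert p T₀) hzK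
    lift l to List I using hl
    exact ⟨l, h⟩
  by_cases hκ : cls ⟨y, hj hyN⟩ = cls ⟨x, hxV⟩
  · -- A path from `y` to `x` enters `N k`, and a chain of sheets from `y` ends there.
    obtain ⟨K, hK, hKV, hyK, z, hzK, hzN⟩ := JoinedIn.exists_isPreconnected
      (joinedIn_iff_joined (hj hyN) hxV |>.2 (hcls.1 hκ)) hyx
      ((hN.isPlaque k).isOpen.mem_nhds (hN.mem k))
    obtain ⟨l, P, hP, hzP, hl⟩ := hchain K hK hKV hyK z hzK
    have hzU := sdiff_subset_sdiff_left hVU (hKV hzK)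
    obtain ⟨w, hw, -, hwT⟩ := hU.exists_mem_proj_zero_mem hfm hT (hOreg z hzU) hzU.1
      (hP.inter (hN.isPlaque k).isOpen) ⟨hzP, hzN⟩
    exact hyA (l, Sum.inl ⟨_, hwT⟩) ⟨w, ⟨hw.2, rfl⟩, hl w hw.1⟩
  · -- A chain of sheets from `y` ends at the representative of its path component.
    obtain ⟨-, hrep2⟩ := hrep _ ⟨⟨y, hj hyN⟩, hyp, rfl⟩
    obtain ⟨l, P, hP, hzP, hl⟩ := hchain (Subtype.val '' pathComponent (⟨y, hj hyN⟩ : V))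
      (isPathConnected_pathComponent.isConnected.isPreconnected.image _
        continuous_subtype_val.continuousOn) (by
        rintro _ ⟨w, hw, rfl⟩
        refine ⟨w.2, fun hwx => hκ (hcls.2 ?_)⟩
        have : w = ⟨x, hxV⟩ := Subtype.ext hwx
        exact this ▸ hw) ⟨_, mem_pathComponent_self _, rfl⟩ _
      ⟨_, (hcls.1 hrep2).symm, rfl⟩
    exact hyA (l, Sum.inr _) ⟨_, rfl, hl _ hzP⟩
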